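/- **Model.** Let $\Pi$ be a finite set of $n$ processes. Each $p\in\Pi$ has an identity $id(p)$; different processes may have the same identity. A process knows its own identity, $n$ and $t$, but not the identities of the other processes. Time is discrete. A process may crash (stop taking steps); it is *correct* in a run if it never crashes, and *faulty* otherwise. Processes are asynchronous: a correct process keeps executing its tasks, at an arbitrary speed. $broadcast(m)$ sends one copy of $m$ to every process, including the sender; if a process crashes while broadcasting, an arbitrary subset of the processes gets the message. Links are asynchronous and reliable (no loss for correct receivers, no duplication, corruption or creation; arbitrary finite delays, no ordering), and a received message does not reveal its sender. For $S\subseteq\Pi$, $I(S)$ is the multiset of the identities of the processes in $S$. A failure detector of class $H\Omega$ gives each process $p$ at each time $\tau$ an identity $h\_leader_p^\tau$ and a number $h\_multiplicity_p^\tau\in\mathbb N$, such that there are $\ell\in I(Correct)$ and a time $\tau$ with $h\_leader_p^{\tau'}=\ell$ and $h\_multiplicity_p^{\tau'}=\mathrm{mult}_{I(Correct)}(\ell)$ for all $\tau'\ge\tau$ and all correct $p$. **Algorithm** (code of $p$, using a detector $D\in H\Omega$; proposed values come from a totally ordered set not containing $\bot$). $propose(v_p)$: set $est1_p:=v_p$,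 $r_p:=0$ and start tasks T1 and T2; a $return$ in either task ends $propose$ and stops both tasks. Task T1: repeat forever 1. $r_p:=r_p+1$. 2. (Leaders' coordination) Broadcast $(COORD,id(p),r_p,est1_p)$. Wait until $D.h\_leader_p\ne id(p)$ or at least $D.h\_multiplicity_p$ messages $(COORD,id(p),r_p,-)$ have been received. If some message $(COORD,id(p),r_p,-)$ has been received, set $est1_p$ to the minimum of the estimates in the received messages of this form. 3. (Phase 0) Wait until $D.h\_leader_p=id(p)$ or some $(PH0,r_p,v)$ has been received. If some $(PH0,r_p,v)$ has been received, set $est1_p:=v$ for such a $v$. Broadcast $(PH0,r_p,est1_p)$. 4. (Phase 1) Broadcast $(PH1,r_p,est1_p)$. Wait until at least $n-t$ messages $(PH1,r_p,-)$ have been received. If more than $n/2$ of the received ones carry the same value $v$, set $est2_p:=v$, else $est2_p:=\bot$. 5. (Phase 2) Broadcast $(PH2,r_p,est2_p)$. Wait until at least $n-t$ messages $(PH2,r_p,-)$ have been received. Let $rec_p$ be the set of all values carried by the received ones. If $rec_p=\{v\}$ with $v\neq\bot$, broadcast $(DECIDE,v)$ and $return(v)$. If $rec_p=\{v,\bot\}$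 with $v\ne\bot$, set $est1_p:=v$. Task T2: upon reception of some $(DECIDE,v)$, broadcast $(DECIDE,v)$ and $return(v)$. **Theorem.** If $t<n/2$, this algorithm solves consensus in homonymous asynchronous systems with at most $t$ crashes and a failure detector of class $H\Omega$: for every assignment of identities and of proposed values, every run in which every process proposes its value and at most $t$ processes are faulty, and every detector $D$ of class $H\Omega$ for that run, - (Validity) every decided (that is, returned) value was proposed by some process; - (Agreement) no two different values are decided, whether by correct or by faulty processes; - (Termination) every correct process eventually decides. -/

import Mathlib

universe u v w x y z

namespace Homonymous

/-! ### Homonymous asynchronous message-passing systems with crash failures -/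

/-- The code run by a process, split into concurrent tasks.  One step of a task executes one
statement; it may query the failure detector and look at the multiset of messages received so far
(a reception does not reveal the sender), and it may broadcast one message.  The code gets the
identity of the process executing it, but neither the set of processes nor their identities, so
processes with the same identity are indistinguishable. -/
structure Algorithm (ID : Type u) (FD : Type v) (V : Type w) where
  /-- local states -/
  State : Type x
  /-- messages -/
  Msg : Type y
  /-- concurrent tasks of a process -/
  Task : Type
  /-- state of a process of the given identity that has just invoked `propose` with a value -/
  start : ID → V → State
  /-- `step i d rcvd k s out s'`: a process with identity `i`, current detector output `d`, received
  messages `rcvd` and state `s` may execute a statement of task `k`, broadcasting `out` (if any) and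
  moving to `s'`. -/
  step : ID → FD → Multiset Msg → Task → State → Option Msg → State → Prop
  /-- the value returned by `propose`, if it has returned -/
  returned : State → Option V

/-- A global configuration. -/
structure Config {ID : Type u} {FD : Type v} {V : Type w}
    (A : Algorithm.{u, v, w, x, y} ID FD V) (Proc : Type z) where
  /-- local state of each process -/
  state : Proc → A.State
  /-- processes that have crashed -/
  crashed : Set Proc
  /-- `transit p q`: messages sent on the link from `p` to `q` and not yet received -/
  transit : Proc → Proc → Multiset A.Msg
  /-- messages received by each process so far -/
  received : Proc → Multiset A.Msg

/-- What may happen at one tick of the global clock. -/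
inductive Event {ID : Type u} {FD : Type v} {V : Type w}
    (A : Algorithm.{u, v, w, x, y} ID FD V) (Proc : Type z) where
  /-- nothing happens -/
  | idle
  /-- `p` executes one step of task `k` -/
  | step (p : Proc) (k : A.Task)
  /-- `p` crashes between two statements -/
  | crash (p : Proc)
  /-- `p` crashes while executing a broadcast of task `k`: only the links to `S` get the message -/
  | crashBroadcast (p : Proc) (k : A.Task) (S : Finset Proc)
  /-- a message `m` is received on the link from `p` to `q` -/
  | deliver (p q : Proc) (m : A.Msg)

section Model

variable {ID : Type u} {FD : Type v} {V : Type w} {A : Algorithm.{u, v, w, x, y} ID FD V}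
  {Proc : Type z} [Fintype Proc] [DecidableEq Proc]

/-- Configuration in which every process has proposed and nothing has happened yet. -/
def Config.start (A : Algorithm.{u, v, w, x, y} ID FD V) (ident : Proc → ID)
    (proposal : Proc → V) : Config A Proc where
  state p := A.start (ident p) (proposal p)
  crashed := ∅
  transit _ _ := 0
  received _ := 0

/-- Put one copy of the message `out` (if any) on the link from `p` to each process of `S`. -/
def addToLinks (transit : Proc → Proc → Multiset A.Msg) (p : Proc) (S : Finset Proc)
    (out : Option A.Msg) : Proc → Proc → Multiset A.Msg :=
  fun a b => if a = p ∧ b ∈ S then transit a b + out.elim 0 (fun m => {m}) else transit a b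

/-- `Trans ident d c e c'`: with failure detector outputs `d`, the event `e` may lead from the
configuration `c` to `c'`. -/
inductive Trans (ident : Proc → ID) (d : Proc → FD) (c : Config A Proc) :
    Event A Proc → Config A Proc → Prop
  | idle : Trans ident d c .idle c
  | step (p : Proc) (k : A.Task) (out : Option A.Msg) (s' : A.State)
      (alive : p ∉ c.crashed)
      (exec : A.step (ident p) (d p) (c.received p) k (c.state p) out s') :
      Trans ident d c (.step p k)
        { c with
          state := Function.update c.state p s'
          transit := addToLinks c.transit p Finset.univ out }
  | crash (p : Proc) (alive : p ∉ c.crashed) :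
      Trans ident d c (.crash p) { c with crashed := insert p c.crashed }
  | crashBroadcast (p : Proc) (k : A.Task) (S : Finset Proc) (m : A.Msg) (s' : A.State)
      (alive : p ∉ c.crashed)
      (exec : A.step (ident p) (d p) (c.received p) k (c.state p) (some m) s') :
      Trans ident d c (.crashBroadcast p k S)
        { c with
          crashed := insert p c.crashed
          transit := addToLinks c.transit p S (some m) }
  | deliver (p q : Proc) (m : A.Msg) (rest : Multiset A.Msg)
      (pending : c.transit p q = m ::ₘ rest) :
      Trans ident d c (.deliver p q m)
        { c with
          transit := fun a b => if a = p ∧ b = q then rest else c.transit a b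
          received := Function.update c.received q (m ::ₘ c.received q) }

/-- A run in which process `p` has identity `ident p` and proposes `proposal p`, and in which the
failure detector outputs `D τ p` at process `p` at time `τ`. -/
structure Run (A : Algorithm.{u, v, w, x, y} ID FD V) (ident : Proc → ID) (proposal : Proc → V)
    (D : ℕ → Proc → FD) where
  /-- the configuration at each time -/
  config : ℕ → Config A Proc
  /-- the event that occurs at each time -/
  event : ℕ → Event A Proc
  config_zero : config 0 = Config.start A ident proposal
  trans : ∀ τ, Trans ident (D τ) (config τ) (event τ) (config (τ + 1))

namespace Run

variable {ident : Proc → ID} {proposal : Proc → V} {D : ℕ → Proc → FD}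

open Classical in
/-- The processes that never crash. -/
noncomputable def correct (R : Run A ident proposal D) : Finset Proc :=
  Finset.univ.filter fun p => ∀ τ, p ∉ (R.config τ).crashed

/-- Processes are asynchronous (a correct process keeps executing each of its tasks, at arbitrary
speed) and links are asynchronous and reliable (a message sent to a correct process is received
after an arbitrary finite delay). -/
structure Admissible (R : Run A ident proposal D) : Prop where
  fair : ∀ p ∈ R.correct, ∀ (k : A.Task) (τ : ℕ), ∃ τ' ≥ τ, R.event τ' = .step p k
  reliable : ∀ (p : Proc), ∀ q ∈ R.correct, ∀ (τ : ℕ) (m : A.Msg),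
    m ∈ (R.config τ).transit p q → ∃ τ' ≥ τ, R.event τ' = .deliver p q m

/-- At time `τ`, process `p` has decided `a`. -/
def Decided (R : Run A ident proposal D) (p : Proc) (τ : ℕ) (a : V) : Prop :=
  A.returned ((R.config τ).state p) = some a

/-- The requirements of consensus. -/
structure Consensus (R : Run A ident proposal D) : Prop where
  /-- a decided value was proposed -/
  validity : ∀ p τ a, R.Decided p τ a → ∃ q, proposal q = a
  /-- no two different values are ever decided, by correct or faulty processes -/
  agreement : ∀ p q τ τ' a b, R.Decided p τ a → R.Decided q τ' b → a = b
  /-- every correct process decides -/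
  termination : ∀ p ∈ R.correct, ∃ τ a, R.Decided p τ a

end Run

/-- `A` solves consensus among the processes `Proc`, whatever their identities and proposals, in
every run with at most `t` crashes using a failure detector of class `C`; the class is a predicate
on the identities, the set of correct processes and the detector history. -/
def SolvesConsensus (Proc : Type z) [Fintype Proc] [DecidableEq Proc]
    (A : Algorithm.{u, v, w, x, y} ID FD V) (t : ℕ)
    (C : (Proc → ID) → Finset Proc → (ℕ → Proc → FD) → Prop) : Prop :=
  ∀ (ident : Proc → ID) (proposal : Proc → V) (D : ℕ → Proc → FD) (R : Run A ident proposal D),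
    R.Admissible → R.correctᶜ.card ≤ t → C ident R.correct D → R.Consensus

end Model

/-! ### The failure detector class HΩ -/

/-- The two variables provided by a detector of class HΩ. -/
structure HOmegaOutput (ID : Type u) where
  /-- the identity of the current leaders -/
  leader : ID
  /-- the number of current leaders -/
  multiplicity : ℕ

/-- The multiset `I(S)` of the identities of the processes in `S`. -/
def identities {ID : Type u} {Proc : Type z} (ident : Proc → ID) (S : Finset Proc) : Multiset ID :=
  S.val.map ident

/-- Class HΩ: eventually and forever, all correct processes get the same identity `ℓ` of some correct
process, and the number of correct processes with that identity. -/
def HOmega {ID : Type u} [DecidableEq ID] {Proc : Type z} (ident : Proc → ID)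
    (correct : Finset Proc) (D : ℕ → Proc → HOmegaOutput ID) : Prop :=
  ∃ ℓ ∈ identities ident correct, ∃ τ, ∀ τ' ≥ τ, ∀ p ∈ correct,
    (D τ' p).leader = ℓ ∧ (D τ' p).multiplicity = (identities ident correct).count ℓ

/-! ### The consensus algorithm using HΩ -/

/-- Messages; the value `⊥` of an estimate `est2` is `none`. -/
inductive Msg (ID : Type u) (V : Type w) where
  | coord (i : ID) (r : ℕ) (est1 : V)
  | ph0 (r : ℕ) (est1 : V)
  | ph1 (r : ℕ) (est1 : V)
  | ph2 (r : ℕ) (est2 : Option V)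
  | decide (a : V)

section Received

variable {ID : Type u} {V : Type w}

/-- The estimates of the messages `(COORD, i, r, -)` in `rcvd`. -/
def coordValues [DecidableEq ID] (i : ID) (r : ℕ) (rcvd : Multiset (Msg ID V)) : Multiset V :=
  rcvd.filterMap fun
    | .coord j r' a => if j = i ∧ r' = r then some a else none
    | _ => none

/-- The estimates of the messages `(PH0, r, -)` in `rcvd`. -/
def ph0Values (r : ℕ) (rcvd : Multiset (Msg ID V)) : Multiset V :=
  rcvd.filterMap fun
    | .ph0 r' a => if r' = r then some a else none
    | _ => none

/-- The estimates of the messages `(PH1, r, -)` in `rcvd`. -/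
def ph1Values (r : ℕ) (rcvd : Multiset (Msg ID V)) : Multiset V :=
  rcvd.filterMap fun
    | .ph1 r' a => if r' = r then some a else none
    | _ => none

/-- The estimates of the messages `(PH2, r, -)` in `rcvd`. -/
def ph2Values (r : ℕ) (rcvd : Multiset (Msg ID V)) : Multiset (Option V) :=
  rcvd.filterMap fun
    | .ph2 r' e => if r' = r then some e else none
    | _ => none

end Received

/-- The next statement of task T1. -/
inductive Pc1 (V : Type w) where
  | roundStart
  | coordBroadcast
  | coordWait
  | coordUpdate
  | ph0Wait
  | ph0Update
  | ph0Broadcast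
  | ph1Broadcast
  | ph1Wait
  | ph1Update
  | ph2Broadcast
  | ph2Wait
  | ph2Evaluate
  | decideBroadcast (a : V)
  | decideReturn (a : V)

/-- The next statement of task T2. -/
inductive Pc2 (V : Type w) where
  | listening
  | relayed (a : V)

/-- The two tasks of a process. -/
inductive TaskName where
  | T1
  | T2

/-- Local state of a process.  Once `result` is set, `propose` has returned and both tasks have
stopped. -/
structure LocalState (V : Type w) where
  round : ℕ
  est1 : V
  est2 : Option V
  pc1 : Pc1 V
  pc2 : Pc2 V
  result : Option V

section Code

variable {ID : Type u} {V : Type w} [DecidableEq ID] [LinearOrder V]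

/-- One statement of task T1.  Waiting is repeated evaluation of the guard: evaluating a guard that
is false leaves the state unchanged. -/
inductive Step1 (n t : ℕ) (i : ID) (d : HOmegaOutput ID) (rcvd : Multiset (Msg ID V))
    (s : LocalState V) : Option (Msg ID V) → LocalState V → Prop
  | roundStart (h : s.pc1 = .roundStart) :
      Step1 n t i d rcvd s none { s with round := s.round + 1, pc1 := .coordBroadcast }
  -- Leaders' coordination phase
  | coordBroadcast (h : s.pc1 = .coordBroadcast) :
      Step1 n t i d rcvd s (some (.coord i s.round s.est1)) { s with pc1 := .coordWait }
  | coordPass (h : s.pc1 = .coordWait)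
      (guard : d.leader ≠ i ∨ d.multiplicity ≤ (coordValues i s.round rcvd).card) :
      Step1 n t i d rcvd s none { s with pc1 := .coordUpdate }
  | coordBlocked (h : s.pc1 = .coordWait)
      (guard : ¬ (d.leader ≠ i ∨ d.multiplicity ≤ (coordValues i s.round rcvd).card)) :
      Step1 n t i d rcvd s none s
  | coordUpdate (h : s.pc1 = .coordUpdate) (a : V)
      (least : IsLeast {b | b ∈ coordValues i s.round rcvd} a) :
      Step1 n t i d rcvd s none { s with est1 := a, pc1 := .ph0Wait }
  | coordSkip (h : s.pc1 = .coordUpdate) (empty : coordValues i s.round rcvd = 0) :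
      Step1 n t i d rcvd s none { s with pc1 := .ph0Wait }
  -- Phase 0
  | ph0Pass (h : s.pc1 = .ph0Wait) (guard : d.leader = i ∨ ph0Values s.round rcvd ≠ 0) :
      Step1 n t i d rcvd s none { s with pc1 := .ph0Update }
  | ph0Blocked (h : s.pc1 = .ph0Wait) (guard : ¬ (d.leader = i ∨ ph0Values s.round rcvd ≠ 0)) :
      Step1 n t i d rcvd s none s
  | ph0Update (h : s.pc1 = .ph0Update) (a : V) (mem : a ∈ ph0Values s.round rcvd) :
      Step1 n t i d rcvd s none { s with est1 := a, pc1 := .ph0Broadcast }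
  | ph0Skip (h : s.pc1 = .ph0Update) (empty : ph0Values s.round rcvd = 0) :
      Step1 n t i d rcvd s none { s with pc1 := .ph0Broadcast }
  | ph0Broadcast (h : s.pc1 = .ph0Broadcast) :
      Step1 n t i d rcvd s (some (.ph0 s.round s.est1)) { s with pc1 := .ph1Broadcast }
  -- Phase 1
  | ph1Broadcast (h : s.pc1 = .ph1Broadcast) :
      Step1 n t i d rcvd s (some (.ph1 s.round s.est1)) { s with pc1 := .ph1Wait }
  | ph1Pass (h : s.pc1 = .ph1Wait) (guard : n - t ≤ (ph1Values s.round rcvd).card) :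
      Step1 n t i d rcvd s none { s with pc1 := .ph1Update }
  | ph1Blocked (h : s.pc1 = .ph1Wait) (guard : ¬ n - t ≤ (ph1Values s.round rcvd).card) :
      Step1 n t i d rcvd s none s
  | ph1Majority (h : s.pc1 = .ph1Update) (a : V)
      (majority : n < 2 * (ph1Values s.round rcvd).count a) :
      Step1 n t i d rcvd s none { s with est2 := some a, pc1 := .ph2Broadcast }
  | ph1NoMajority (h : s.pc1 = .ph1Update)
      (no_majority : ¬ ∃ a, n < 2 * (ph1Values s.round rcvd).count a) :
      Step1 n t i d rcvd s none { s with est2 := none, pc1 := .ph2Broadcast }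
  -- Phase 2
  | ph2Broadcast (h : s.pc1 = .ph2Broadcast) :
      Step1 n t i d rcvd s (some (.ph2 s.round s.est2)) { s with pc1 := .ph2Wait }
  | ph2Pass (h : s.pc1 = .ph2Wait) (guard : n - t ≤ (ph2Values s.round rcvd).card) :
      Step1 n t i d rcvd s none { s with pc1 := .ph2Evaluate }
  | ph2Blocked (h : s.pc1 = .ph2Wait) (guard : ¬ n - t ≤ (ph2Values s.round rcvd).card) :
      Step1 n t i d rcvd s none s
  | ph2Decide (h : s.pc1 = .ph2Evaluate) (a : V)
      (rec_eq : {e | e ∈ ph2Values s.round rcvd} = {some a}) :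
      Step1 n t i d rcvd s none { s with pc1 := .decideBroadcast a }
  | ph2Adopt (h : s.pc1 = .ph2Evaluate) (a : V)
      (rec_eq : {e | e ∈ ph2Values s.round rcvd} = {some a, none}) :
      Step1 n t i d rcvd s none { s with est1 := a, pc1 := .roundStart }
  | ph2Skip (h : s.pc1 = .ph2Evaluate)
      (rec_ne : ¬ ∃ a, {e | e ∈ ph2Values s.round rcvd} = {some a})
      (rec_ne_bot : ¬ ∃ a, {e | e ∈ ph2Values s.round rcvd} = {some a, none}) :
      Step1 n t i d rcvd s none { s with pc1 := .roundStart }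
  | decideBroadcast (a : V) (h : s.pc1 = .decideBroadcast a) :
      Step1 n t i d rcvd s (some (.decide a)) { s with pc1 := .decideReturn a }
  | decideReturn (a : V) (h : s.pc1 = .decideReturn a) :
      Step1 n t i d rcvd s none { s with result := some a }

/-- One statement of task T2. -/
inductive Step2 (rcvd : Multiset (Msg ID V)) (s : LocalState V) :
    Option (Msg ID V) → LocalState V → Prop
  | blocked (h : s.pc2 = .listening) (none_received : ∀ a, Msg.decide a ∉ rcvd) :
      Step2 rcvd s none s
  | relay (h : s.pc2 = .listening) (a : V) (mem : Msg.decide a ∈ rcvd) :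
      Step2 rcvd s (some (.decide a)) { s with pc2 := .relayed a }
  | relayReturn (a : V) (h : s.pc2 = .relayed a) :
      Step2 rcvd s none { s with result := some a }

/-- The consensus algorithm using a detector of class HΩ, for `n` processes of which at most `t` may
crash. -/
def hOmegaConsensus (ID : Type u) (V : Type w) [DecidableEq ID] [LinearOrder V] (n t : ℕ) :
    Algorithm ID (HOmegaOutput ID) V where
  State := LocalState V
  Msg := Msg ID V
  Task := TaskName
  start _ a :=
    { round := 0, est1 := a, est2 := none, pc1 := .roundStart, pc2 := .listening, result := none }
  step i d rcvd k s out s' :=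
    if s.result = none then
      match k with
      | .T1 => Step1 n t i d rcvd s out s'
      | .T2 => Step2 rcvd s out s'
    else out = none ∧ s' = s
  returned s := s.result

end Code

end Homonymous

/-! Safety is quorum intersection; termination comes from one good round.

A process broadcasts at most one message per phase of a round, so the copies a receiver counts,
although anonymous, come from distinct senders. Hence two values cannot both be carried by a
majority of the PH1 messages of a round (`Majority.unique`), and all non-`⊥` PH2 values of a round
coincide. A decision requires that `n - t` processes sent the same PH2 value (`locked_of_decide`).
As `2 * t < n`, every other quorum of that round meets these senders, so every process that goes on
to the next round takes the decided value along, and no other value occurs later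
(`Locked.value_eq`). This gives agreement (`Locked.unique`). Validity holds because estimates are
only copied from proposals and messages (`Locked.proposed`).

For termination, suppose some correct process never decides. Since DECIDE is broadcast before
returning, nobody returns at all. Then no wait blocks a correct process forever
(`Elects.exists_le_pos`): `n - t` correct processes feed the quorums, the correct leaders feed the
coordination phase, and a leader frees the others in Phase 0. So rounds grow without bound. Take a
round that nobody has reached when all crashes are over and the detector is stable. In it the
leaders wait for exactly the coordination messages that are ever sent, all adopt the same minimum
(`Elects.coordValues_eq`), and this value fills every later phase. The round can only end in a
decision (`Elects.pos_le`), a contradiction. -/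

set_option linter.unusedSectionVars false

namespace Homonymous

/-! ### Runs as traces of snapshots with complete message histories -/

section Traces

variable {ID : Type u} {FD : Type v} {V : Type w} {A : Algorithm.{u, v, w, x, y} ID FD V}
  {Proc : Type z} [Fintype Proc] [DecidableEq Proc]

/-- A configuration in which messages are recorded forever: `sent p` are the messages that `p` has
begun to broadcast, `link p q` those that `q` has received from `p`.  The state of a process that
crashes while broadcasting is the one it would have reached. -/
structure Snapshot (A : Algorithm.{u, v, w, x, y} ID FD V) (Proc : Type z) where
  state : Proc → A.State
  sent : Proc → Multiset A.Msg
  link : Proc → Proc → Multiset A.Msg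

/-- Process `p` executes a statement of task `k` between two snapshots. -/
def Snapshot.Moves (ident : Proc → ID) (d : Proc → FD) (g g' : Snapshot A Proc) (p : Proc)
    (k : A.Task) : Prop :=
  ∃ out : Option A.Msg,
    A.step (ident p) (d p) (∑ q, g.link q p) k (g.state p) out (g'.state p) ∧
      g'.sent p = out.elim 0 (fun m => {m}) + g.sent p

/-- The history of a run, seen through snapshots. -/
structure Trace (A : Algorithm.{u, v, w, x, y} ID FD V) (ident : Proc → ID) (proposal : Proc → V)
    (D : ℕ → Proc → FD) where
  snap : ℕ → Snapshot A Proc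
  alive : ℕ → Proc → Prop
  state_zero : ∀ p, (snap 0).state p = A.start (ident p) (proposal p)
  sent_zero : ∀ p, (snap 0).sent p = 0
  dynamics : ∀ τ p,
    ((snap (τ + 1)).state p = (snap τ).state p ∧ (snap (τ + 1)).sent p = (snap τ).sent p) ∨
      (alive τ p ∧ ∃ k, Snapshot.Moves ident (D τ) (snap τ) (snap (τ + 1)) p k)
  alive_of_succ : ∀ τ p, alive (τ + 1) p → alive τ p
  link_le_sent : ∀ τ p q, (snap τ).link p q ≤ (snap τ).sent p
  link_le_succ : ∀ τ p q, (snap τ).link p q ≤ (snap (τ + 1)).link p q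
  fair : ∀ p, (∀ τ, alive τ p) → ∀ (k : A.Task) τ,
    ∃ τ' ≥ τ, Snapshot.Moves ident (D τ') (snap τ') (snap (τ' + 1)) p k
  reliable : ∀ τ p q m, alive τ p → (∀ τ, alive τ q) → m ∈ (snap τ).sent p →
    ∃ τ', m ∈ (snap τ').link p q

/-- A snapshot records the history leading to a configuration. -/
structure Snapshot.Records (g : Snapshot A Proc) (c : Config A Proc) : Prop where
  state_eq : ∀ p ∉ c.crashed, g.state p = c.state p
  returned_eq : ∀ p, A.returned (g.state p) = A.returned (c.state p)
  received_eq : ∀ q, c.received q = ∑ p, g.link p q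
  transit_add_link : ∀ p q, p ∉ c.crashed → c.transit p q + g.link p q = g.sent p
  transit_add_link_le : ∀ p q, c.transit p q + g.link p q ≤ g.sent p

/-- The snapshot `g'` follows `g` when the event `e` occurs in the configuration `c`. -/
structure Snapshot.Follows (ident : Proc → ID) (d : Proc → FD) (c : Config A Proc)
    (e : Event A Proc) (g g' : Snapshot A Proc) : Prop where
  dynamics : ∀ p, (g'.state p = g.state p ∧ g'.sent p = g.sent p) ∨
    (p ∉ c.crashed ∧ ∃ k, Snapshot.Moves ident d g g' p k)
  link_le : ∀ p q, g.link p q ≤ g'.link p q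
  moves : ∀ p k, e = .step p k → Snapshot.Moves ident d g g' p k
  delivered : ∀ p q m, e = .deliver p q m → m ∈ g'.link p q

/-- The snapshot completes the statement that a crash interrupts, so a trace knows no partial
broadcasts: some links to a crashed sender's receivers merely fall short of `sent`. Decisions are
unaffected because, by `returned_broadcast`, a broadcasting statement never changes the returned
value. -/
theorem Snapshot.Records.exists_follows
    (returned_broadcast : ∀ i d rcvd k s m s', A.step i d rcvd k s (some m) s' →
      A.returned s' = A.returned s)
    {ident : Proc → ID} {d : Proc → FD} {c c' : Config A Proc} {e : Event A Proc}
    {g : Snapshot A Proc} (hg : g.Records c) (h : Trans ident d c e c') :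
    ∃ g' : Snapshot A Proc, g'.Records c' ∧ Snapshot.Follows ident d c e g g' := by
  cases h with
  | idle =>
    exact ⟨g, hg, fun p => .inl ⟨rfl, rfl⟩, fun p q => le_rfl, by simp, by simp⟩
  | step p k out s' alive exec =>
    have hmove : Snapshot.Moves ident d g
        { g with
          state := Function.update g.state p s'
          sent := Function.update g.sent p (out.elim 0 (fun m => {m}) + g.sent p) } p k := by
      refine ⟨out, ?_, by simp⟩
      rw [← hg.received_eq, hg.state_eq p alive]
      simpa using exec
    refine ⟨{ g with
          state := Function.update g.state p s'
          sent := Function.update g.sent p (out.elim 0 (fun m => {m}) + g.sent p) },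
        ⟨?_, ?_, hg.received_eq, ?_, ?_⟩, ?_, fun _ _ => le_rfl, ?_, by simp⟩
    · intro q hq
      by_cases h : q = p
      · subst h; simp
      · simpa [h] using hg.state_eq q hq
    · intro q
      by_cases h : q = p
      · subst h; simp
      · simpa [h] using hg.returned_eq q
    · intro a b ha
      have := hg.transit_add_link a b ha
      by_cases h : a = p
      · subst h
        simp only [addToLinks, Finset.mem_univ, and_self, if_true, Function.update_self]
        rw [← this]; abel
      · simpa [addToLinks, h] using this
    · intro a b
      have := hg.transit_add_link_le a b
      by_cases h : a = p
      · subst h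
        simp only [addToLinks, Finset.mem_univ, and_self, if_true, Function.update_self]
        rw [add_comm (c.transit a b), add_assoc]
        gcongr
      · simpa [addToLinks, h] using this
    · intro q
      by_cases h : q = p
      · subst h; exact .inr ⟨alive, k, hmove⟩
      · exact .inl (by simp [h])
    · intro q k' h
      cases h
      exact hmove
  | crash p alive =>
    refine ⟨g, ⟨fun q hq => hg.state_eq q fun h => hq (Or.inr h), hg.returned_eq, hg.received_eq,
      fun a b ha => hg.transit_add_link a b fun h => ha (Or.inr h), hg.transit_add_link_le⟩,
      fun p => .inl ⟨rfl, rfl⟩, fun p q => le_rfl, by simp, by simp⟩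
  | crashBroadcast p k S m s' alive exec =>
    refine ⟨{ g with
          state := Function.update g.state p s'
          sent := Function.update g.sent p ({m} + g.sent p) },
        ⟨?_, ?_, hg.received_eq, ?_, ?_⟩, ?_, fun _ _ => le_rfl, by simp, by simp⟩
    · intro q hq
      have h : q ≠ p := fun h => hq (Or.inl h)
      simpa [h] using hg.state_eq q fun h => hq (Or.inr h)
    · intro q
      by_cases h : q = p
      · subst h
        simpa using returned_broadcast _ _ _ _ _ _ _ exec
      · simpa [h] using hg.returned_eq q
    · intro a b ha
      have h : a ≠ p := fun h => ha (Or.inl h)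
      simpa [addToLinks, h] using hg.transit_add_link a b fun h => ha (Or.inr h)
    · intro a b
      have := hg.transit_add_link_le a b
      by_cases h : a = p
      · subst h
        by_cases hb : b ∈ S
        · simp only [addToLinks, hb, and_self, if_true, Function.update_self, Option.elim]
          rw [add_comm (c.transit a b), add_assoc]
          gcongr
        · simp only [addToLinks, hb, and_false, if_false, Function.update_self]
          exact this.trans (Multiset.le_add_left _ _)
      · simpa [addToLinks, h] using this
    · intro q
      by_cases h : q = p
      · subst h
        refine .inr ⟨alive, k, some m, ?_, by simp⟩
        rw [← hg.received_eq, hg.state_eq q alive]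
        simpa using exec
      · exact .inl (by simp [h])
  | deliver p q m rest pending =>
    -- A delivery moves `m` from `transit` to `link` and preserves their sum.
    have key : ∀ a b, (if a = p ∧ b = q then rest else c.transit a b) +
        (if a = p ∧ b = q then m ::ₘ g.link a b else g.link a b) =
        c.transit a b + g.link a b := by
      intro a b
      by_cases h : a = p ∧ b = q
      · obtain ⟨rfl, rfl⟩ := h
        simp [pending]
      · simp [h]
    refine ⟨{ g with link := fun a b => if a = p ∧ b = q then m ::ₘ g.link a b else g.link a b },
        ⟨hg.state_eq, hg.returned_eq, ?_, ?_, ?_⟩, fun p => .inl ⟨rfl, rfl⟩, ?_, by simp, ?_⟩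
    · intro b
      by_cases h : b = q
      · subst h
        have : ∀ a, (if a = p ∧ b = b then m ::ₘ g.link a b else g.link a b) =
            (if a = p then {m} else 0) + g.link a b := by
          intro a
          by_cases h : a = p <;> simp [h]
        refine Eq.trans ?_ (Finset.sum_congr rfl fun a _ => this a).symm
        simp [Finset.sum_add_distrib, hg.received_eq]
      · simpa [h] using hg.received_eq b
    · intro a b ha
      exact (key a b).trans (hg.transit_add_link a b ha)
    · intro a b
      exact (key a b).le.trans (hg.transit_add_link_le a b)
    · intro a b
      by_cases h : a = p ∧ b = q
      · simpa [h] using Multiset.le_cons_self _ _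
      · simp [h]
    · intro a b m' h
      cases h
      simp

theorem Trans.crashed_subset {ident : Proc → ID} {d : Proc → FD} {c c' : Config A Proc}
    {e : Event A Proc} (h : Trans ident d c e c') : c.crashed ⊆ c'.crashed := by
  cases h <;> simp

theorem Run.Admissible.exists_trace
    (returned_broadcast : ∀ i d rcvd k s m s', A.step i d rcvd k s (some m) s' →
      A.returned s' = A.returned s)
    {ident : Proc → ID} {proposal : Proc → V} {D : ℕ → Proc → FD}
    {R : Run A ident proposal D} (hR : R.Admissible) :
    ∃ T : Trace A ident proposal D,
      (∀ τ p, A.returned ((T.snap τ).state p) = A.returned ((R.config τ).state p)) ∧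
        ∀ p, (∀ τ, T.alive τ p) ↔ p ∈ R.correct := by
  have hcorrect : ∀ p, (∀ τ, p ∉ (R.config τ).crashed) ↔ p ∈ R.correct := by
    simp [Run.correct]
  have hex : ∀ τ (g : {g : Snapshot A Proc // g.Records (R.config τ)}),
      ∃ g' : {g : Snapshot A Proc // g.Records (R.config (τ + 1))},
        Snapshot.Follows ident (D τ) (R.config τ) (R.event τ) g.1 g'.1 := fun τ g =>
    let ⟨g', h, h'⟩ := g.2.exists_follows returned_broadcast (R.trans τ)
    ⟨⟨g', h⟩, h'⟩
  choose next hnext using hex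
  have hinit : Snapshot.Records (A := A)
      ⟨fun p => A.start (ident p) (proposal p), fun _ => 0, fun _ _ => 0⟩ (R.config 0) := by
    rw [R.config_zero]
    constructor <;> simp [Config.start]
  let seq : ∀ τ, {g : Snapshot A Proc // g.Records (R.config τ)} :=
    fun τ => Nat.rec ⟨_, hinit⟩ next τ
  have hseq : ∀ τ, Snapshot.Follows ident (D τ) (R.config τ) (R.event τ)
      (seq τ).1 (seq (τ + 1)).1 := fun τ => hnext τ (seq τ)
  refine ⟨⟨fun τ => (seq τ).1, fun τ p => p ∉ (R.config τ).crashed, fun _ => rfl, fun _ => rfl,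
    fun τ => (hseq τ).dynamics, fun τ p h h' => h ((R.trans τ).crashed_subset h'), ?_,
    fun τ => (hseq τ).link_le, ?_, ?_⟩, fun τ => (seq τ).2.returned_eq, hcorrect⟩
  · intro τ p q
    exact (Multiset.le_add_left _ _).trans ((seq τ).2.transit_add_link_le p q)
  · intro p hp k τ
    obtain ⟨τ', h, h'⟩ := hR.fair p ((hcorrect p).1 hp) k τ
    exact ⟨τ', h, (hseq τ').moves p k h'⟩
  · intro τ p q m hp hq hm
    -- For a sender not yet crashed the link balance is exact: the message is either pending, and
    -- reliability delivers it, or already received.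
    rw [← (seq τ).2.transit_add_link p q hp, Multiset.mem_add] at hm
    rcases hm with hm | hm
    · obtain ⟨τ', -, h⟩ := hR.reliable p q ((hcorrect q).1 hq) τ m hm
      exact ⟨τ' + 1, (hseq τ').delivered p q m h⟩
    · exact ⟨τ, hm⟩

end Traces

/-! ### Positions within task T1 and the slots of messages -/

section Positions

variable {ID : Type u} {V : Type w}

/-- The rank of a statement of task T1 within a round. -/
def Pc1.stage : Pc1 V → ℕ
  | .coordBroadcast => 0
  | .coordWait => 1
  | .coordUpdate => 2
  | .ph0Wait => 3
  | .ph0Update => 4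
  | .ph0Broadcast => 5
  | .ph1Broadcast => 6
  | .ph1Wait => 7
  | .ph1Update => 8
  | .ph2Broadcast => 9
  | .ph2Wait => 10
  | .ph2Evaluate => 11
  | .decideBroadcast _ => 12
  | .decideReturn _ => 13
  -- Incrementing the round from here gives the next position, `16 * (r + 1)`; the initial position
  -- is 15. Rank 14 is never taken, which leaves a gap between deciding in a round and leaving it.
  | .roundStart => 15

/-- The position of a process in its execution of task T1. -/
def LocalState.pos (s : LocalState V) : ℕ := 16 * s.round + s.pc1.stage

/-- The position at which a message of task T1 is broadcast. -/
def Msg.slot : Msg ID V → Option ℕ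
  | .coord _ r _ => some (16 * r)
  | .ph0 r _ => some (16 * r + 5)
  | .ph1 r _ => some (16 * r + 6)
  | .ph2 r _ => some (16 * r + 9)
  | .decide _ => none

/-- The positions at which the messages of a round are broadcast. -/
def IsSlot (k : ℕ) : Prop := k % 16 = 0 ∨ k % 16 = 5 ∨ k % 16 = 6 ∨ k % 16 = 9

/-- The state of a process that has just proposed `a`. -/
def LocalState.initial (a : V) : LocalState V :=
  { round := 0, est1 := a, est2 := none, pc1 := .roundStart, pc2 := .listening, result := none }

theorem LocalState.pos_mod (s : LocalState V) : s.pos % 16 = s.pc1.stage := by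
  unfold LocalState.pos
  cases s.pc1 <;> simp [Pc1.stage]

theorem LocalState.pos_div (s : LocalState V) : s.pos / 16 = s.round := by
  unfold LocalState.pos
  cases s.pc1 <;> simp [Pc1.stage] <;> omega

section Received

variable [DecidableEq ID] {M : Multiset (Msg ID V)} {i : ID} {r : ℕ} {a : V}

theorem mem_coordValues : a ∈ coordValues i r M ↔ Msg.coord i r a ∈ M := by
  simp only [coordValues, Multiset.mem_filterMap]
  constructor
  · rintro ⟨m, hm, h⟩
    cases m <;> simp at h
    obtain ⟨⟨rfl, rfl⟩, rfl⟩ := h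
    exact hm
  · exact fun h => ⟨_, h, by simp⟩

omit [DecidableEq ID] in
theorem mem_ph0Values : a ∈ ph0Values r M ↔ Msg.ph0 r a ∈ M := by
  simp only [ph0Values, Multiset.mem_filterMap]
  constructor
  · rintro ⟨m, hm, h⟩
    cases m <;> simp at h
    obtain ⟨rfl, rfl⟩ := h
    exact hm
  · exact fun h => ⟨_, h, by simp⟩

omit [DecidableEq ID] in
theorem mem_ph1Values : a ∈ ph1Values r M ↔ Msg.ph1 r a ∈ M := by
  simp only [ph1Values, Multiset.mem_filterMap]
  constructor
  · rintro ⟨m, hm, h⟩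
    cases m <;> simp at h
    obtain ⟨rfl, rfl⟩ := h
    exact hm
  · exact fun h => ⟨_, h, by simp⟩

omit [DecidableEq ID] in
theorem mem_ph2Values {e : Option V} : e ∈ ph2Values r M ↔ Msg.ph2 r e ∈ M := by
  simp only [ph2Values, Multiset.mem_filterMap]
  constructor
  · rintro ⟨m, hm, h⟩
    cases m <;> simp at h
    obtain ⟨rfl, rfl⟩ := h
    exact hm
  · exact fun h => ⟨_, h, by simp⟩

end Received

section Code

variable [DecidableEq ID] [LinearOrder V] {n t : ℕ} {i : ID} {d : HOmegaOutput ID}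
  {rcvd : Multiset (Msg ID V)} {s s' : LocalState V} {out : Option (Msg ID V)}

/-- Positions encode the message history: a statement standing at a slot broadcasts the message of
that slot, and silent jumps pass over no slot. DECIDE has no slot and leaves from stage 12. -/
theorem Step1.pos_out (h : Step1 n t i d rcvd s out s') :
    (out = none ∧ s.pos ≤ s'.pos ∧ ∀ k, s.pos ≤ k → k < s'.pos → ¬ IsSlot k) ∨
      (∃ m, out = some m ∧ m.slot = some s.pos ∧ s'.pos = s.pos + 1) ∨
      ∃ a, out = some (.decide a) ∧ s.pos % 16 = 12 ∧ s'.pos = s.pos + 1 := by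
  cases h <;> simp_all [LocalState.pos, Pc1.stage, Msg.slot, IsSlot]
  case roundStart => exact ⟨by omega, fun k h1 h2 => by omega⟩
  all_goals intro k h1 h2; omega

theorem Step1.pos_le (h : Step1 n t i d rcvd s out s') : s.pos ≤ s'.pos := by
  rcases h.pos_out with h | ⟨_, h⟩ | ⟨_, h⟩ <;> omega

theorem Step2.pos_eq (h : Step2 rcvd s out s') : s'.pos = s.pos := by
  cases h <;> rfl

theorem Step2.out_eq (h : Step2 rcvd s out s') : out = none ∨ ∃ a, out = some (.decide a) := by
  cases h <;> simp

/-- A statement of task T1 that makes no progress. -/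
theorem Step1.of_pos_le (h : Step1 n t i d rcvd s out s') (hs : s'.pos ≤ s.pos) :
    (s.pos % 16 = 1 ∧ ¬ (d.leader ≠ i ∨ d.multiplicity ≤ (coordValues i s.round rcvd).card)) ∨
      (s.pos % 16 = 3 ∧ ¬ (d.leader = i ∨ ph0Values s.round rcvd ≠ 0)) ∨
      (s.pos % 16 = 7 ∧ ¬ n - t ≤ (ph1Values s.round rcvd).card) ∨
      (s.pos % 16 = 10 ∧ ¬ n - t ≤ (ph2Values s.round rcvd).card) ∨
      ∃ a, s.pc1 = .decideReturn a := by
  rw [LocalState.pos_mod]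
  cases h with
  | coordBlocked h guard => exact .inl ⟨by simp [h, Pc1.stage], guard⟩
  | ph0Blocked h guard => exact .inr (.inl ⟨by simp [h, Pc1.stage], guard⟩)
  | ph1Blocked h guard => exact .inr (.inr (.inl ⟨by simp [h, Pc1.stage], guard⟩))
  | ph2Blocked h guard => exact .inr (.inr (.inr (.inl ⟨by simp [h, Pc1.stage], guard⟩)))
  | decideReturn a h => exact .inr (.inr (.inr (.inr ⟨a, h⟩)))
  | _ => simp_all [LocalState.pos, Pc1.stage] <;> omega

theorem hOmegaConsensus_returned_broadcast (i : ID) (d : HOmegaOutput ID)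
    (rcvd : Multiset (Msg ID V)) (k : TaskName) (s : LocalState V) (m : Msg ID V)
    (s' : LocalState V) (h : (hOmegaConsensus ID V n t).step i d rcvd k s (some m) s') :
    s'.result = s.result := by
  simp only [hOmegaConsensus] at h
  split_ifs at h with hs
  · cases k
    · cases (h : Step1 _ _ _ _ _ _ _ _) <;> rfl
    · cases (h : Step2 _ _ _ _) ; rfl
  · simp at h

end Code

end Positions

/-! ### Invariants of traces and the counting of anonymous messages -/

namespace Trace

section Basic

variable {ID : Type u} {V : Type w} [DecidableEq ID] [LinearOrder V] {n t : ℕ}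
  {Proc : Type z} [Fintype Proc] [DecidableEq Proc] {ident : Proc → ID} {proposal : Proc → V}
  {D : ℕ → Proc → HOmegaOutput ID}
  (T : Trace (hOmegaConsensus ID V n t) ident proposal D)

/-- The state of `p` at time `τ`. -/
def st (τ : ℕ) (p : Proc) : LocalState V := (T.snap τ).state p

/-- The messages that `p` has begun to broadcast. -/
def hist (τ : ℕ) (p : Proc) : Multiset (Msg ID V) := (T.snap τ).sent p

/-- The messages that `q` has received from `p`. -/
def link (τ : ℕ) (p q : Proc) : Multiset (Msg ID V) := (T.snap τ).link p q

/-- The messages that `p` has received. -/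
def rcvd (τ : ℕ) (p : Proc) : Multiset (Msg ID V) := ∑ q, T.link τ q p

theorem moves_cases {τ : ℕ} {p : Proc} {k : TaskName}
    (h : Snapshot.Moves ident (D τ) (T.snap τ) (T.snap (τ + 1)) p k) :
    ((T.st τ p).result ≠ none ∧ T.st (τ + 1) p = T.st τ p ∧ T.hist (τ + 1) p = T.hist τ p) ∨
      ∃ out, (T.st τ p).result = none ∧
        T.hist (τ + 1) p = out.elim 0 (fun m => {m}) + T.hist τ p ∧
        match k with
        | .T1 => Step1 n t (ident p) (D τ p) (T.rcvd τ p) (T.st τ p) out (T.st (τ + 1) p)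
        | .T2 => Step2 (T.rcvd τ p) (T.st τ p) out (T.st (τ + 1) p) := by
  obtain ⟨out, h, h'⟩ := h
  change (if (T.st τ p).result = none then _ else _) at h
  split_ifs at h with hs
  · refine .inr ⟨out, hs, h', ?_⟩
    cases k <;> exact h
  · obtain ⟨rfl, h⟩ := h
    exact .inl ⟨hs, h, h'.trans (zero_add _)⟩

theorem step_cases (τ : ℕ) (p : Proc) :
    (T.st (τ + 1) p = T.st τ p ∧ T.hist (τ + 1) p = T.hist τ p) ∨
      T.alive τ p ∧ (T.st τ p).result = none ∧ ∃ out,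
        T.hist (τ + 1) p = out.elim 0 (fun m => {m}) + T.hist τ p ∧
        (Step1 n t (ident p) (D τ p) (T.rcvd τ p) (T.st τ p) out (T.st (τ + 1) p) ∨
          Step2 (T.rcvd τ p) (T.st τ p) out (T.st (τ + 1) p)) := by
  rcases T.dynamics τ p with h | ⟨ha, k, h⟩
  · exact .inl h
  · rcases T.moves_cases h with h | ⟨out, hs, h, h'⟩
    · exact .inl h.2
    · refine .inr ⟨ha, hs, out, h, ?_⟩
      cases k
      · exact .inl h'
      · exact .inr h'

/-- The induction hypothesis covers all processes, because what `p` receives at time `τ` lies in the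
histories of the others at that time. -/
theorem induct (I : ℕ → Proc → LocalState V → Multiset (Msg ID V) → Prop)
    (zero : ∀ p, I 0 p (.initial (proposal p)) 0)
    (stay : ∀ τ p s h, I τ p s h → I (τ + 1) p s h)
    (step1 : ∀ τ p out s', T.alive τ p → (T.st τ p).result = none →
      (∀ q, I τ q (T.st τ q) (T.hist τ q)) →
      Step1 n t (ident p) (D τ p) (T.rcvd τ p) (T.st τ p) out s' →
      I (τ + 1) p s' (out.elim 0 (fun m => {m}) + T.hist τ p))
    (step2 : ∀ τ p out s', T.alive τ p → (T.st τ p).result = none →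
      (∀ q, I τ q (T.st τ q) (T.hist τ q)) →
      Step2 (T.rcvd τ p) (T.st τ p) out s' →
      I (τ + 1) p s' (out.elim 0 (fun m => {m}) + T.hist τ p))
    (τ : ℕ) : ∀ p, I τ p (T.st τ p) (T.hist τ p) := by
  induction τ with
  | zero =>
    intro p
    have h1 : T.st 0 p = .initial (proposal p) := T.state_zero p
    have h2 : T.hist 0 p = 0 := T.sent_zero p
    rw [h1, h2]
    exact zero p
  | succ τ ih =>
    intro p
    rcases T.step_cases τ p with ⟨h1, h2⟩ | ⟨ha, hs, out, h1, h2⟩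
    · rw [h1, h2]
      exact stay τ p _ _ (ih p)
    · rw [h1]
      rcases h2 with h2 | h2
      · exact step1 τ p out _ ha hs ih h2
      · exact step2 τ p out _ ha hs ih h2

theorem hist_mono (p : Proc) : Monotone fun τ => T.hist τ p := by
  refine monotone_nat_of_le_succ fun τ => ?_
  rcases T.step_cases τ p with ⟨-, h⟩ | ⟨-, -, out, h, -⟩
  · exact h.ge
  · simp only [h]
    exact Multiset.le_add_left _ _

theorem mem_hist_mono {τ τ' : ℕ} (h : τ ≤ τ') {p : Proc} {m : Msg ID V} (hm : m ∈ T.hist τ p) :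
    m ∈ T.hist τ' p :=
  Multiset.mem_of_le (T.hist_mono p h) hm

theorem pos_mono (p : Proc) : Monotone fun τ => (T.st τ p).pos := by
  refine monotone_nat_of_le_succ fun τ => ?_
  rcases T.step_cases τ p with ⟨h, -⟩ | ⟨-, -, out, -, h | h⟩
  · simp [h]
  · exact h.pos_le
  · exact h.pos_eq.ge

theorem link_mono (p q : Proc) : Monotone fun τ => T.link τ p q :=
  monotone_nat_of_le_succ fun τ => T.link_le_succ τ p q

theorem rcvd_mono (p : Proc) : Monotone fun τ => T.rcvd τ p :=
  fun _ _ h => Finset.sum_le_sum fun q _ => T.link_mono q p h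

theorem link_le_hist (τ : ℕ) (p q : Proc) : T.link τ p q ≤ T.hist τ p := T.link_le_sent τ p q

theorem link_le_rcvd (τ : ℕ) (p q : Proc) : T.link τ p q ≤ T.rcvd τ q :=
  Finset.single_le_sum (f := fun p => T.link τ p q) (fun _ _ => Multiset.zero_le _)
    (Finset.mem_univ p)

theorem exists_mem_hist {τ : ℕ} {p : Proc} {m : Msg ID V} (h : m ∈ T.rcvd τ p) :
    ∃ q, m ∈ T.hist τ q := by
  simp only [rcvd, Multiset.mem_sum, Finset.mem_univ, true_and] at h
  obtain ⟨q, h⟩ := h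
  exact ⟨q, Multiset.mem_of_le (T.link_le_hist τ q p) h⟩

theorem alive_anti (p : Proc) {τ τ' : ℕ} (h : τ ≤ τ') (ha : T.alive τ' p) : T.alive τ p := by
  induction h with
  | refl => exact ha
  | step _ ih => exact ih (T.alive_of_succ _ _ ha)

/-- The broadcasts of a process are governed by its position: each slot from 16 up to the position
is filled exactly once, and no other. Uniqueness drives the quorum arguments; existence drives
liveness. -/
theorem slots (τ : ℕ) (p : Proc) :
    15 ≤ (T.st τ p).pos ∧
      (∀ m ∈ T.hist τ p, ∀ k, m.slot = some k → 16 ≤ k ∧ k < (T.st τ p).pos) ∧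
      (∀ k, ((T.hist τ p).filter fun m => m.slot = some k).card ≤ 1) ∧
      ∀ k, 16 ≤ k → k < (T.st τ p).pos → IsSlot k → ∃ m ∈ T.hist τ p, m.slot = some k := by
  refine T.induct (fun _ _ s h => 15 ≤ s.pos ∧
      (∀ m ∈ h, ∀ k, m.slot = some k → 16 ≤ k ∧ k < s.pos) ∧
      (∀ k, (h.filter fun m => m.slot = some k).card ≤ 1) ∧
      ∀ k, 16 ≤ k → k < s.pos → IsSlot k → ∃ m ∈ h, m.slot = some k) ?_ ?_ ?_ ?_ τ p
  · intro p
    have : (LocalState.initial (proposal p)).pos = 15 := rfl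
    simp only [this]
    refine ⟨le_rfl, by simp, by simp, fun k _ _ => by omega⟩
  · exact fun _ _ _ _ h => h
  · intro τ p out s' _ _ ih h
    obtain ⟨h1, h2, h3, h4⟩ := ih p
    refine ⟨h1.trans h.pos_le, ?_⟩
    rcases h.pos_out with ⟨rfl, hp, hk⟩ | ⟨m, rfl, hm, hp⟩ | ⟨a, rfl, ha, hp⟩
    · simp only [Option.elim, zero_add]
      refine ⟨fun m hm k hk => ⟨(h2 m hm k hk).1, (h2 m hm k hk).2.trans_le hp⟩, h3,
        fun k h16 hlt hs => h4 k h16 (lt_of_not_ge fun hge => hk k hge hlt hs) hs⟩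
    · have hslot : IsSlot (T.st τ p).pos := by
        cases m <;> simp only [Msg.slot, Option.some.injEq, reduceCtorEq] at hm <;>
          rw [← hm] <;> unfold IsSlot <;> omega
      -- The position is at least 15, and 15 is not a slot.
      have h16 : 16 ≤ (T.st τ p).pos := by
        unfold IsSlot at hslot; omega
      simp only [Option.elim, Multiset.singleton_add]
      refine ⟨?_, ?_, ?_⟩
      · intro m' hm' k hk
        rcases Multiset.mem_cons.1 hm' with rfl | hm'
        · rw [hm] at hk
          cases hk
          omega
        · have := h2 m' hm' k hk
          omega
      · intro k
        by_cases hk : m.slot = some k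
        -- Earlier messages occupy slots below the current position, so this slot was still empty.
        · have : (T.hist τ p).filter (fun m => m.slot = some k) = 0 := by
            refine Multiset.filter_eq_nil.2 fun m' hm' hk' => ?_
            have := (h2 m' hm' k hk').2
            rw [hm] at hk
            cases hk
            omega
          simp [hk, this]
        · simpa [hk] using h3 k
      · intro k hk hlt hs
        rcases Nat.lt_or_ge k (T.st τ p).pos with hlt' | hge
        · obtain ⟨m', hm', h⟩ := h4 k hk hlt' hs
          exact ⟨m', Multiset.mem_cons_of_mem hm', h⟩
        · obtain rfl : k = (T.st τ p).pos := by omega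
          exact ⟨m, Multiset.mem_cons_self _ _, hm⟩
    · simp only [Option.elim, Multiset.singleton_add]
      refine ⟨?_, ?_, ?_⟩
      · intro m' hm' k hk
        rcases Multiset.mem_cons.1 hm' with rfl | hm'
        · simp [Msg.slot] at hk
        · have := h2 m' hm' k hk
          omega
      · intro k
        rw [Multiset.filter_cons_of_neg _ (by simp [Msg.slot])]
        exact h3 k
      · intro k hk hlt hs
        have : k ≠ (T.st τ p).pos := by rintro rfl; unfold IsSlot at hs; omega
        obtain ⟨m', hm', h⟩ := h4 k hk (by omega) hs
        exact ⟨m', Multiset.mem_cons_of_mem hm', h⟩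
  · intro τ p out s' _ _ ih h
    rw [h.pos_eq]
    rcases h.out_eq with rfl | ⟨a, rfl⟩
    · simpa using ih p
    · obtain ⟨h1, h2, h3, h4⟩ := ih p
      simp only [Option.elim, Multiset.singleton_add]
      refine ⟨h1, ?_, ?_, ?_⟩
      · intro m' hm' k hk
        rcases Multiset.mem_cons.1 hm' with rfl | hm'
        · simp [Msg.slot] at hk
        · exact h2 m' hm' k hk
      · intro k
        rw [Multiset.filter_cons_of_neg _ (by simp [Msg.slot])]
        exact h3 k
      · intro k hk hlt hs
        obtain ⟨m', hm', h⟩ := h4 k hk hlt hs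
        exact ⟨m', Multiset.mem_cons_of_mem hm', h⟩

theorem lt_pos {τ : ℕ} {p : Proc} {m : Msg ID V} {k : ℕ} (hm : m ∈ T.hist τ p)
    (hk : m.slot = some k) : k < (T.st τ p).pos :=
  ((T.slots τ p).2.1 m hm k hk).2

theorem le_slot {τ : ℕ} {p : Proc} {m : Msg ID V} {k : ℕ} (hm : m ∈ T.hist τ p)
    (hk : m.slot = some k) : 16 ≤ k :=
  ((T.slots τ p).2.1 m hm k hk).1

theorem eq_of_slot_eq {τ τ' : ℕ} {p : Proc} {m m' : Msg ID V} {k : ℕ} (hm : m ∈ T.hist τ p)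
    (hm' : m' ∈ T.hist τ' p) (hk : m.slot = some k) (hk' : m'.slot = some k) : m = m' := by
  have h := (T.slots (max τ τ') p).2.2.1 k
  have h1 := (Multiset.mem_filter (p := fun m => m.slot = some k)).2
    ⟨T.mem_hist_mono (le_max_left τ τ') hm, hk⟩
  have h2 := (Multiset.mem_filter (p := fun m => m.slot = some k)).2
    ⟨T.mem_hist_mono (le_max_right τ τ') hm', hk'⟩
  generalize (T.hist (max τ τ') p).filter (fun m => m.slot = some k) = M at h h1 h2
  obtain ⟨M, rfl⟩ := Multiset.exists_cons_of_mem h1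
  have : M = 0 := by simpa using h
  subst this
  exact (Multiset.mem_singleton.1 h2).symm

/-- Only the identity of the sender is broadcast in a coordination message. -/
theorem eq_ident_of_coord (τ : ℕ) (p : Proc) :
    ∀ i r a, Msg.coord i r a ∈ T.hist τ p → i = ident p := by
  refine T.induct (fun _ p _ h => ∀ i r a, Msg.coord i r a ∈ h → i = ident p)
    (by simp) (fun _ _ _ _ h => h) ?_ ?_ τ p
  · intro τ p out s' _ _ ih h i r a hm
    have := ih p i r a
    cases h <;> simp_all
    grind
  · intro τ p out s' _ _ ih h i r a hm
    have := ih p i r a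
    cases h <;> simp_all

theorem card_filterMap_le {α β γ : Type*} [DecidableEq γ] (f : α → Option β) (g : α → γ) (c : γ)
    (hf : ∀ a, (f a).isSome → g a = c) (M : Multiset α) :
    (M.filterMap f).card ≤ (M.filter fun a => g a = c).card := by
  induction M using Multiset.induction with
  | empty => simp
  | cons a M ih =>
    cases h : f a with
    | none =>
      rw [Multiset.filterMap_cons_none _ _ h]
      exact ih.trans (Multiset.card_le_card (Multiset.filter_le_filter _ (Multiset.le_cons_self _ _)))
    | some b =>
      rw [Multiset.filterMap_cons_some _ _ _ h,
        Multiset.filter_cons_of_pos (p := fun a => g a = c) _ (hf a (by simp [h]))]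
      simpa using ih

theorem _root_.Multiset.filterMap_finset_sum {ι α β : Type*} (f : α → Option β) (s : Finset ι)
    (M : ι → Multiset α) : (∑ i ∈ s, M i).filterMap f = ∑ i ∈ s, (M i).filterMap f := by
  classical
  induction s using Finset.induction with
  | empty => simp
  | insert a s ha ih => rw [Finset.sum_insert ha, Finset.sum_insert ha, Multiset.filterMap_add, ih]

variable {β : Type*} (f : Msg ID V → Option β)

theorem card_filterMap_link_le_one {k : ℕ} (hf : ∀ m, (f m).isSome → m.slot = some k) (τ : ℕ)
    (p q : Proc) : ((T.link τ p q).filterMap f).card ≤ 1 :=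
  (card_filterMap_le f Msg.slot _ hf _).trans <|
    (Multiset.card_le_card (Multiset.filter_le_filter _ (T.link_le_hist τ p q))).trans
      ((T.slots τ p).2.2.1 k)

theorem filterMap_rcvd (τ : ℕ) (p : Proc) :
    (T.rcvd τ p).filterMap f = ∑ q, (T.link τ q p).filterMap f :=
  Multiset.filterMap_finset_sum _ _ _

-- When `f` selects messages of a single slot, each link contributes at most one of them. Counting
-- copies of a value thus bounds from below the number of distinct senders, even though receptions
-- are anonymous.
open Classical in
theorem count_filterMap_rcvd_le [DecidableEq β] {k : ℕ} (hf : ∀ m, (f m).isSome → m.slot = some k)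
    (τ : ℕ) (p : Proc) (b : β) : ((T.rcvd τ p).filterMap f).count b ≤
      (Finset.univ.filter fun q => ∃ m ∈ T.link τ q p, f m = some b).card := by
  rw [filterMap_rcvd, Multiset.count_sum', Finset.card_filter]
  refine Finset.sum_le_sum fun q _ => ?_
  split_ifs with h
  · exact (Multiset.count_le_card _ _).trans (T.card_filterMap_link_le_one f hf τ q p)
  · refine (Multiset.count_eq_zero.2 fun hb => h ?_).le
    simpa using hb

open Classical in
theorem card_filterMap_rcvd_le {k : ℕ} (hf : ∀ m, (f m).isSome → m.slot = some k) (τ : ℕ)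
    (p : Proc) : ((T.rcvd τ p).filterMap f).card ≤
      (Finset.univ.filter fun q => ∃ m ∈ T.link τ q p, (f m).isSome).card := by
  rw [filterMap_rcvd, Multiset.card_sum, Finset.card_filter]
  refine Finset.sum_le_sum fun q _ => ?_
  split_ifs with h
  · exact T.card_filterMap_link_le_one f hf τ q p
  · refine (Multiset.card_eq_zero.2 (Multiset.eq_zero_of_forall_notMem fun b hb => h ?_)).le
    obtain ⟨m, hm, hb⟩ := (Multiset.mem_filterMap _ _).1 hb
    exact ⟨m, hm, by simp [hb]⟩

/-- Process `q` broadcasts `m` at some time. -/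
def Sent (q : Proc) (m : Msg ID V) : Prop := ∃ τ, m ∈ T.hist τ q

variable {T}

theorem Sent.eq {q : Proc} {m m' : Msg ID V} {k : ℕ} (h : T.Sent q m) (h' : T.Sent q m')
    (hk : m.slot = some k) (hk' : m'.slot = some k) : m = m' :=
  T.eq_of_slot_eq h.choose_spec h'.choose_spec hk hk'

theorem sent_of_mem_link {τ : ℕ} {p q : Proc} {m : Msg ID V} (h : m ∈ T.link τ p q) :
    T.Sent p m :=
  ⟨τ, Multiset.mem_of_le (T.link_le_hist τ p q) h⟩

theorem exists_sent_of_mem_rcvd {τ : ℕ} {p : Proc} {m : Msg ID V} (h : m ∈ T.rcvd τ p) :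
    ∃ q, T.Sent q m :=
  let ⟨q, h⟩ := T.exists_mem_hist h
  ⟨q, τ, h⟩

variable (T)

open Classical in
theorem count_ph1Values_le (τ : ℕ) (p : Proc) (r : ℕ) (a : V) :
    (ph1Values r (T.rcvd τ p)).count a ≤
      (Finset.univ.filter fun q => T.Sent q (.ph1 r a)).card := by
  refine (T.count_filterMap_rcvd_le _ (k := 16 * r + 6) ?_ τ p a).trans (Finset.card_le_card ?_)
  · intro m
    cases m <;> simp [Msg.slot]
  · refine Finset.monotone_filter_right _ fun q _ ⟨m, hm, h⟩ => ?_
    cases m <;> simp at h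
    obtain ⟨rfl, rfl⟩ := h
    exact sent_of_mem_link hm

open Classical in
theorem card_ph2Values_le (τ : ℕ) (p : Proc) (r : ℕ) : (ph2Values r (T.rcvd τ p)).card ≤
    (Finset.univ.filter fun q => ∃ e, Msg.ph2 r e ∈ T.link τ q p).card := by
  refine (T.card_filterMap_rcvd_le _ (k := 16 * r + 9) ?_ τ p).trans (Finset.card_le_card ?_)
  · intro m
    cases m <;> simp [Msg.slot]
  · refine Finset.monotone_filter_right _ fun q _ ⟨m, hm, h⟩ => ?_
    cases m <;> simp at h
    subst h
    exact ⟨_, hm⟩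

open Classical in
theorem card_coordValues_le (τ : ℕ) (p : Proc) (i : ID) (r : ℕ) :
    (coordValues i r (T.rcvd τ p)).card ≤
      (Finset.univ.filter fun q => ∃ a, Msg.coord i r a ∈ T.link τ q p).card := by
  refine (T.card_filterMap_rcvd_le _ (k := 16 * r) ?_ τ p).trans (Finset.card_le_card ?_)
  · intro m
    cases m <;> simp [Msg.slot]
  · refine Finset.monotone_filter_right _ fun q _ ⟨m, hm, h⟩ => ?_
    cases m <;> simp at h
    obtain ⟨rfl, rfl⟩ := h
    exact ⟨_, hm⟩

end Basic

end Trace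

/-! ### Safety: majorities, locked values, agreement and validity -/

namespace Trace

section Safety

variable {ID : Type u} {V : Type w} [DecidableEq ID] [LinearOrder V] {t : ℕ}
  {Proc : Type z} [Fintype Proc] [DecidableEq Proc] {ident : Proc → ID} {proposal : Proc → V}
  {D : ℕ → Proc → HOmegaOutput ID}
  (T : Trace (hOmegaConsensus ID V (Fintype.card Proc) t) ident proposal D)

open Classical in
/-- A majority of the processes broadcast `(PH1, r, a)`. -/
def Majority (r : ℕ) (a : V) : Prop :=
  Fintype.card Proc < 2 * (Finset.univ.filter fun q => T.Sent q (.ph1 r a)).card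

open Classical in
/-- At least `n - t` processes broadcast `(PH2, r, a)`. -/
def Locked (r : ℕ) (a : V) : Prop :=
  Fintype.card Proc - t ≤ (Finset.univ.filter fun q => T.Sent q (.ph2 r (some a))).card

variable {T}

/-- Two majorities share a process, and a process fills the PH1 slot of a round only once. -/
theorem Majority.unique {r : ℕ} {a b : V} (ha : T.Majority r a) (hb : T.Majority r b) :
    a = b := by
  classical
  by_contra hab
  have hdisj : Disjoint (Finset.univ.filter fun q => T.Sent q (.ph1 r a))
      (Finset.univ.filter fun q => T.Sent q (.ph1 r b)) := by
    rw [Finset.disjoint_filter]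
    intro q _ h h'
    have := h.eq h' (k := 16 * r + 6) rfl rfl
    cases this
    exact hab rfl
  have h := Finset.card_le_univ ((Finset.univ.filter fun q => T.Sent q (.ph1 r a)) ∪
      (Finset.univ.filter fun q => T.Sent q (.ph1 r b)))
  rw [Finset.card_union_of_disjoint hdisj] at h
  unfold Majority at ha hb
  omega

theorem majority_of_ph2 {r : ℕ} {a : V} {p : Proc} (h : T.Sent p (.ph2 r (some a))) :
    T.Majority r a := by
  obtain ⟨τ, h⟩ := h
  suffices H : ((T.st τ p).pc1 = .ph2Broadcast → ∀ a, (T.st τ p).est2 = some a →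
      T.Majority (T.st τ p).round a) ∧ ∀ r a, Msg.ph2 r (some a) ∈ T.hist τ p → T.Majority r a from
    H.2 r a h
  clear h r a
  refine T.induct (fun _ _ s h => (s.pc1 = .ph2Broadcast → ∀ a, s.est2 = some a →
      T.Majority s.round a) ∧ ∀ r a, Msg.ph2 r (some a) ∈ h → T.Majority r a)
    (by simp [LocalState.initial]) (fun _ _ _ _ h => h) ?_ ?_ τ p
  · intro τ p out s' _ _ ih h
    obtain ⟨ih1, ih2⟩ := ih p
    cases h with
    | ph1Majority h a majority =>
      refine ⟨fun _ b hb => ?_, by simpa using ih2⟩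
      cases hb
      refine majority.trans_le (Nat.mul_le_mul_left 2 (T.count_ph1Values_le τ p _ a))
    | ph2Broadcast h =>
      refine ⟨by simp, fun r a ha => ?_⟩
      simp only [Option.elim, Multiset.singleton_add, Multiset.mem_cons, Msg.ph2.injEq] at ha
      rcases ha with ⟨rfl, ha⟩ | ha
      · exact ih1 h a ha.symm
      · exact ih2 r a ha
    | _ => simp_all
  · intro τ p out s' _ _ ih h
    obtain ⟨ih1, ih2⟩ := ih p
    cases h <;> simp_all

variable (T)

/-- The guard and the evaluation are separate statements. The quorum found by the guard persists
because received messages only accumulate. -/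
theorem quorum_rcvd (τ : ℕ) (p : Proc) :
    ((T.st τ p).pc1 = .ph1Update →
      Fintype.card Proc - t ≤ (ph1Values (T.st τ p).round (T.rcvd τ p)).card) ∧
    ((T.st τ p).pc1 = .ph2Evaluate →
      Fintype.card Proc - t ≤ (ph2Values (T.st τ p).round (T.rcvd τ p)).card) := by
  have mono1 : ∀ τ p r, (ph1Values r (T.rcvd τ p)).card ≤
      (ph1Values r (T.rcvd (τ + 1) p)).card := fun τ p r =>
    Multiset.card_le_card (Multiset.filterMap_le_filterMap _ (T.rcvd_mono p τ.le_succ))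
  have mono2 : ∀ τ p r, (ph2Values r (T.rcvd τ p)).card ≤
      (ph2Values r (T.rcvd (τ + 1) p)).card := fun τ p r =>
    Multiset.card_le_card (Multiset.filterMap_le_filterMap _ (T.rcvd_mono p τ.le_succ))
  refine T.induct (fun τ p s _ => (s.pc1 = .ph1Update →
      Fintype.card Proc - t ≤ (ph1Values s.round (T.rcvd τ p)).card) ∧
    (s.pc1 = .ph2Evaluate → Fintype.card Proc - t ≤ (ph2Values s.round (T.rcvd τ p)).card))
    (by simp [LocalState.initial]) ?_ ?_ ?_ τ p
  · exact fun τ p s _ h => ⟨fun hs => (h.1 hs).trans (mono1 τ p _),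
      fun hs => (h.2 hs).trans (mono2 τ p _)⟩
  · intro τ p out s' _ _ ih h
    have h1 := mono1 τ p (T.st τ p).round
    have h2 := mono2 τ p (T.st τ p).round
    cases h with
    | ph1Pass h guard => exact ⟨fun _ => guard.trans h1, by simp⟩
    | ph2Pass h guard => exact ⟨by simp, fun _ => guard.trans h2⟩
    | _ => simp_all
  · intro τ p out s' _ _ ih h
    have h1 := mono1 τ p (T.st τ p).round
    have h2 := mono2 τ p (T.st τ p).round
    have ih := ih p
    cases h <;> exact ⟨fun hs => (ih.1 hs).trans h1, fun hs => (ih.2 hs).trans h2⟩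

/-- Every decision goes back to an evaluation of Phase 2 in which a quorum of distinct senders
carried only this value; relaying a DECIDE inherits the lock of its origin. -/
theorem locked_of_decide (τ : ℕ) (p : Proc) :
    (∀ a, (T.st τ p).pc1 = .decideBroadcast a ∨ (T.st τ p).pc1 = .decideReturn a →
      ∃ r, T.Locked r a) ∧
    (∀ a, (T.st τ p).pc2 = .relayed a → ∃ r, T.Locked r a) ∧
    (∀ a, (T.st τ p).result = some a → ∃ r, T.Locked r a) ∧
    ∀ a, Msg.decide a ∈ T.hist τ p → ∃ r, T.Locked r a := by
  refine T.induct (fun _ _ s h =>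
    (∀ a, s.pc1 = .decideBroadcast a ∨ s.pc1 = .decideReturn a → ∃ r, T.Locked r a) ∧
    (∀ a, s.pc2 = .relayed a → ∃ r, T.Locked r a) ∧
    (∀ a, s.result = some a → ∃ r, T.Locked r a) ∧
    ∀ a, Msg.decide a ∈ h → ∃ r, T.Locked r a)
    (by simp [LocalState.initial]) (fun _ _ _ _ h => h) ?_ ?_ τ p
  · intro τ p out s' _ _ ih h
    obtain ⟨ih1, ih2, ih3, ih4⟩ := ih p
    cases h with
    | ph2Decide h a rec_eq =>
      classical
      refine ⟨fun b hb => ?_, ih2, ih3, by simpa using ih4⟩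
      obtain rfl : a = b := by simpa using hb
      refine ⟨(T.st τ p).round, ?_⟩
      refine ((T.quorum_rcvd τ p).2 h).trans
        ((T.card_ph2Values_le τ p _).trans (Finset.card_le_card ?_))
      refine Finset.monotone_filter_right _ fun q _ ⟨e, he⟩ => ?_
      have : e ∈ ({some a} : Set (Option V)) := by
        rw [← rec_eq]
        exact mem_ph2Values.2 (Multiset.mem_of_le (T.link_le_rcvd τ q p) he)
      obtain rfl : e = some a := this
      exact sent_of_mem_link he
    | _ => simp_all
  · intro τ p out s' _ _ ih h
    obtain ⟨ih1, ih2, ih3, ih4⟩ := ih p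
    cases h with
    | relay h a mem =>
      obtain ⟨q, hq⟩ := T.exists_mem_hist mem
      have := (ih q).2.2.2 a hq
      simp_all
    | _ => simp_all

/-- The value carried by a message that is not a decision. -/
def _root_.Homonymous.Msg.value : Msg ID V → Option V
  | .coord _ _ a => some a
  | .ph0 _ a => some a
  | .ph1 _ a => some a
  | .ph2 _ e => e
  | .decide _ => none

/-- If all processes beginning the round after position `N` have an estimate satisfying `Q`, then
so do all estimates from there on. -/
theorem estimates_of_entry {N : ℕ} (hN : N % 16 = 15) {Q : V → Prop}
    (init : N = 15 → ∀ p, Q (proposal p))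
    (entry : ∀ τ p out s',
      Step1 (Fintype.card Proc) t (ident p) (D τ p) (T.rcvd τ p) (T.st τ p) out s' →
      (T.st τ p).pos < N → N ≤ s'.pos → Q s'.est1) (τ : ℕ) (p : Proc) :
    (N ≤ (T.st τ p).pos → Q (T.st τ p).est1) ∧
    (N ≤ (T.st τ p).pos → (T.st τ p).pc1 = .ph2Broadcast →
      ∀ a, (T.st τ p).est2 = some a → Q a) ∧
    ∀ m ∈ T.hist τ p, ∀ k a, m.slot = some k → N ≤ k → m.value = some a → Q a := by
  refine T.induct (fun _ _ s h => (N ≤ s.pos → Q s.est1) ∧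
    (N ≤ s.pos → s.pc1 = .ph2Broadcast → ∀ a, s.est2 = some a → Q a) ∧
    ∀ m ∈ h, ∀ k a, m.slot = some k → N ≤ k → m.value = some a → Q a)
    ?_ (fun _ _ _ _ h => h) ?_ ?_ τ p
  · intro p
    refine ⟨fun h => init ?_ p, by simp [LocalState.initial], by simp⟩
    have : (LocalState.initial (proposal p)).pos = 15 := rfl
    omega
  · intro τ p out s' _ _ ih h
    obtain ⟨ih1, ih2, ih3⟩ := ih p
    have hrcvd : ∀ m ∈ T.rcvd τ p, ∀ k a, m.slot = some k → N ≤ k → m.value = some a → Q a :=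
      fun m hm => let ⟨q, hq⟩ := T.exists_mem_hist hm; (ih q).2.2 m hq
    have hentry := entry τ p out s' h
    have hle := h.pos_le
    have hout : ∀ m, out = some m → ∀ k a, m.slot = some k → N ≤ k → m.value = some a → Q a := by
      intro m hm k a hk hNk ha
      cases h <;> simp only [Option.some.injEq, reduceCtorEq] at hm <;> subst hm <;>
        simp only [Msg.slot, Msg.value, Option.some.injEq, reduceCtorEq] at hk ha <;>
        simp_all [LocalState.pos, Pc1.stage]
    refine ⟨fun hs => ?_, fun hs => ?_, ?_⟩
    · rcases Nat.lt_or_ge (T.st τ p).pos N with hlt | hge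
      · exact hentry hlt hs
      have ih1 := ih1 hge
      cases h with
      | coordUpdate h a least =>
        -- Since `N % 16 = 15`, a position past `N` at a stage before 15 belongs to a round all of
        -- whose slots are past `N`; so the messages used here are covered by `hrcvd`.
        have hpos : (T.st τ p).pos = 16 * (T.st τ p).round + 2 := by
          simp [LocalState.pos, h, Pc1.stage]
        exact hrcvd _ (mem_coordValues.1 least.1) _ a rfl (by omega) rfl
      | ph0Update h a mem =>
        have hpos : (T.st τ p).pos = 16 * (T.st τ p).round + 4 := by
          simp [LocalState.pos, h, Pc1.stage]
        exact hrcvd _ (mem_ph0Values.1 mem) _ a rfl (by omega) rfl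
      | ph2Adopt h a rec_eq =>
        have hpos : (T.st τ p).pos = 16 * (T.st τ p).round + 11 := by
          simp [LocalState.pos, h, Pc1.stage]
        have mem : some a ∈ ph2Values (T.st τ p).round (T.rcvd τ p) := by
          have : some a ∈ {e | e ∈ ph2Values (T.st τ p).round (T.rcvd τ p)} := by simp [rec_eq]
          exact this
        exact hrcvd _ (mem_ph2Values.1 mem) _ a rfl (by omega) rfl
      | _ => exact ih1
    · cases h with
      | ph1Majority h a majority =>
        have hpos : (T.st τ p).pos = 16 * (T.st τ p).round + 8 := by
          simp [LocalState.pos, h, Pc1.stage]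
        simp only [LocalState.pos, Pc1.stage] at hs
        intro _ b hb
        obtain rfl : a = b := by simpa using hb
        have mem : a ∈ ph1Values (T.st τ p).round (T.rcvd τ p) :=
          Multiset.count_pos.1 (by omega)
        exact hrcvd _ (mem_ph1Values.1 mem) _ a rfl (by omega) rfl
      | _ => simp_all
    · intro m hm
      rcases Multiset.mem_add.1 hm with hm | hm
      · cases out with
        | none => simp at hm
        | some m' =>
          obtain rfl : m = m' := by simpa using hm
          exact hout m rfl
      · exact ih3 m hm
  · intro τ p out s' _ _ ih h
    obtain ⟨ih1, ih2, ih3⟩ := ih p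
    have hpos := h.pos_eq
    rw [hpos]
    have : ∀ m ∈ out.elim 0 (fun m => {m}) + T.hist τ p, ∀ k a, m.slot = some k → N ≤ k →
        m.value = some a → Q a := by
      intro m hm
      rcases Multiset.mem_add.1 hm with hm | hm
      · rcases h.out_eq with rfl | ⟨b, rfl⟩
        · simp at hm
        · obtain rfl : m = .decide b := by simpa using hm
          simp [Msg.slot]
      · exact ih3 m hm
    refine ⟨?_, ?_, this⟩ <;> cases h <;> assumption

variable {T} (ht : 2 * t < Fintype.card Proc)
include ht

theorem Locked.exists_sent {r : ℕ} {a : V} (h : T.Locked r a) :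
    ∃ q, T.Sent q (.ph2 r (some a)) := by
  by_contra! hcon
  simp [Locked, hcon] at h
  omega

theorem Locked.majority {r : ℕ} {a : V} (h : T.Locked r a) : T.Majority r a :=
  majority_of_ph2 (h.exists_sent ht).choose_spec

/-- Two sets of `n - t` processes intersect because `2 * t < n`, and a common process sent a single
PH2 message in the round. -/
theorem Locked.mem_ph2Values {r : ℕ} {a : V} (h : T.Locked r a) {τ : ℕ} {p : Proc}
    (hq : Fintype.card Proc - t ≤ (ph2Values r (T.rcvd τ p)).card) :
    some a ∈ ph2Values r (T.rcvd τ p) := by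
  classical
  have h1 := hq.trans (T.card_ph2Values_le τ p r)
  unfold Locked at h
  obtain ⟨q, hq⟩ : ∃ q, (∃ e, Msg.ph2 r e ∈ T.link τ q p) ∧ T.Sent q (.ph2 r (some a)) := by
    by_contra! hcon
    have hdisj : Disjoint (Finset.univ.filter fun q => ∃ e, Msg.ph2 r e ∈ T.link τ q p)
        (Finset.univ.filter fun q => T.Sent q (.ph2 r (some a))) :=
      Finset.disjoint_filter.2 fun q _ => hcon q
    have := Finset.card_le_univ ((Finset.univ.filter fun q => ∃ e, Msg.ph2 r e ∈ T.link τ q p) ∪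
        (Finset.univ.filter fun q => T.Sent q (.ph2 r (some a))))
    rw [Finset.card_union_of_disjoint hdisj] at this
    omega
  obtain ⟨⟨e, he⟩, hs⟩ := hq
  have := (sent_of_mem_link he).eq hs (k := 16 * r + 9) rfl rfl
  cases this
  exact Homonymous.mem_ph2Values.2 (Multiset.mem_of_le (T.link_le_rcvd τ q p) he)

/-- It suffices to look at the passage out of round `r`. There the locked value has been received
and, by uniqueness of majorities, the only other possible entry is `⊥`. So the process adopts `a` or
decides, and never skips. -/
theorem Locked.value_eq {r : ℕ} {a : V} (h : T.Locked r a) {p : Proc} {m : Msg ID V}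
    (hm : T.Sent p m) {k : ℕ} {b : V} (hk : m.slot = some k) (hr : 16 * r + 15 ≤ k)
    (hb : m.value = some b) : b = a := by
  obtain ⟨τ, hm⟩ := hm
  refine (T.estimates_of_entry (N := 16 * r + 15) (Q := fun b => b = a) (by omega) ?_ ?_ τ p).2.2
    m hm k b hk hr hb
  -- Here `r = 0`, but no message belongs to round 0, so nothing can be locked in it.
  · intro hr
    obtain ⟨q, τ, hq⟩ := h.exists_sent ht
    have := T.le_slot hq (k := 16 * r + 9) rfl
    omega
  · intro τ p out s' hstep hlt hge
    have hmem : ∀ hq : (T.st τ p).pc1 = .ph2Evaluate, (T.st τ p).round = r →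
        some a ∈ ph2Values (T.st τ p).round (T.rcvd τ p) := by
      rintro hq rfl
      exact h.mem_ph2Values ht ((T.quorum_rcvd τ p).2 hq)
    cases hstep with
    -- Position `16 * r + 15` can only be reached from below by ending Phase 2 of round `r`.
    | ph2Adopt h' b rec_eq =>
      simp only [LocalState.pos, h', Pc1.stage] at hlt hge
      have : some a ∈ {e | e ∈ ph2Values (T.st τ p).round (T.rcvd τ p)} := hmem h' (by omega)
      rw [rec_eq] at this
      exact (by simpa using this : a = b).symm
    | ph2Skip h' rec_ne rec_ne_bot =>
      exfalso
      simp only [LocalState.pos, h', Pc1.stage] at hlt hge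
      have hr : (T.st τ p).round = r := by omega
      have ha := hmem h' hr
      have hall : ∀ b, some b ∈ ph2Values (T.st τ p).round (T.rcvd τ p) → b = a := by
        intro b hb
        obtain ⟨q, hq⟩ := exists_sent_of_mem_rcvd (Homonymous.mem_ph2Values.1 hb)
        rw [hr] at hq
        exact (majority_of_ph2 hq).unique (h.majority ht)
      by_cases hnone : none ∈ ph2Values (T.st τ p).round (T.rcvd τ p)
      · refine rec_ne_bot ⟨a, ?_⟩
        ext (_ | b)
        · simpa using hnone
        · simpa using ⟨hall b, fun h => h ▸ ha⟩
      · refine rec_ne ⟨a, ?_⟩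
        ext (_ | b)
        · simpa using hnone
        · simpa using ⟨hall b, fun h => h ▸ ha⟩
    | _ => simp_all [LocalState.pos, Pc1.stage]; omega

theorem Locked.unique {r r' : ℕ} {a b : V} (ha : T.Locked r a) (hb : T.Locked r' b) : a = b := by
  have key : ∀ {r r' : ℕ} {a b : V}, r < r' → T.Locked r a → T.Locked r' b → b = a := by
    intro r r' a b hr ha hb
    obtain ⟨q, hq⟩ := hb.exists_sent ht
    exact ha.value_eq ht hq (k := 16 * r' + 9) rfl (by omega) rfl
  rcases lt_trichotomy r r' with h | rfl | h
  · exact (key h ha hb).symm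
  · exact (ha.majority ht).unique (hb.majority ht)
  · exact key h hb ha

theorem Locked.proposed {r : ℕ} {a : V} (h : T.Locked r a) : ∃ q, proposal q = a := by
  obtain ⟨p, τ, hp⟩ := h.exists_sent ht
  refine (T.estimates_of_entry (N := 15) (Q := fun a => ∃ q, proposal q = a) rfl
    (fun _ p => ⟨p, rfl⟩) ?_ τ p).2.2 _ hp (16 * r + 9) a rfl ?_ rfl
  -- Positions never lie below 15, so with `N = 15` only the proposals enter.
  · intro τ p _ _ _ hlt
    have := (T.slots τ p).1
    omega
  · have := T.le_slot hp (k := 16 * r + 9) rfl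
    omega

end Safety

end Trace

/-! ### Liveness: correct processes are never blocked forever -/

namespace Trace

open Filter

section Liveness

variable {ID : Type u} {V : Type w} [DecidableEq ID] [LinearOrder V] {t : ℕ}
  {Proc : Type z} [Fintype Proc] [DecidableEq Proc] {ident : Proc → ID} {proposal : Proc → V}
  {D : ℕ → Proc → HOmegaOutput ID}
  (T : Trace (hOmegaConsensus ID V (Fintype.card Proc) t) ident proposal D)

theorem eventually_mem_link {τ : ℕ} {p q : Proc} {m : Msg ID V} (hm : m ∈ T.hist τ q)
    (hq : T.alive τ q) (hp : ∀ τ, T.alive τ p) : ∀ᶠ τ in atTop, m ∈ T.link τ q p := by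
  obtain ⟨τ', h⟩ := T.reliable τ q p m hq hp hm
  exact eventually_atTop.2 ⟨τ', fun τ'' h' => Multiset.mem_of_le (T.link_mono q p h') h⟩

theorem relayed_of_le {τ τ' : ℕ} {p : Proc} (h : τ ≤ τ') (hres : ∀ τ, (T.st τ p).result = none)
    {a : V} (ha : (T.st τ p).pc2 = .relayed a) : (T.st τ' p).pc2 = .relayed a := by
  induction h with
  | refl => exact ha
  | @step τ' _ ih =>
    rcases T.step_cases τ' p with ⟨h, -⟩ | ⟨-, -, out, -, h | h⟩
    · rw [h, ih]
    · generalize T.st (τ' + 1) p = s' at h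
      cases h <;> exact ih
    · have hres := hres (τ' + 1)
      generalize T.st (τ' + 1) p = s' at h hres
      cases h <;> simp_all

/-- Fairness of task T2 yields a relaying step and then a returning one, unless the process has
returned before. The decided value is left open, since T1 may return first. -/
theorem decides_of_rcvd {τ : ℕ} {p : Proc} {a : V} (hp : ∀ τ, T.alive τ p)
    (h : Msg.decide a ∈ T.rcvd τ p) : ∃ τ b, (T.st τ p).result = some b := by
  by_contra! hcon
  have hres : ∀ τ, (T.st τ p).result = none := fun τ => Option.eq_none_iff_forall_ne_some.2 (hcon τ)
  have hmove : ∀ τ, ∃ τ' ≥ τ, ∃ out,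
      Step2 (T.rcvd τ' p) (T.st τ' p) out (T.st (τ' + 1) p) := by
    intro τ
    obtain ⟨τ', hτ', hm⟩ := T.fair p hp TaskName.T2 τ
    rcases T.moves_cases hm with h | ⟨out, -, -, h⟩
    · exact absurd (hres τ') h.1
    · exact ⟨τ', hτ', out, h⟩
  have hrelayed : ∀ τ b, (T.st τ p).pc2 ≠ .relayed b := by
    intro τ b hb
    obtain ⟨τ', hτ', out, h⟩ := hmove τ
    have hb := T.relayed_of_le hτ' hres hb
    have hres := hres (τ' + 1)
    generalize T.st (τ' + 1) p = s' at h hres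
    cases h <;> simp_all
  obtain ⟨τ', hτ', out, h'⟩ := hmove τ
  have hmem := Multiset.mem_of_le (T.rcvd_mono p hτ') h
  have hrel := hrelayed (τ' + 1)
  generalize T.st (τ' + 1) p = s' at h' hrel
  cases h' <;> simp_all

/-- A process returns in a statement after its DECIDE broadcast, hence it survived that broadcast.
So even the decision of a process that crashes later reaches every correct process. -/
theorem decide_sent (τ : ℕ) (p : Proc) :
    (∀ a, (T.st τ p).pc1 = .decideReturn a → Msg.decide a ∈ T.hist τ p) ∧
    (∀ a, (T.st τ p).pc2 = .relayed a → Msg.decide a ∈ T.hist τ p) ∧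
    ∀ a, (T.st τ p).result = some a → ∃ τ, T.alive τ p ∧ Msg.decide a ∈ T.hist τ p := by
  refine T.induct (fun _ p s h => (∀ a, s.pc1 = .decideReturn a → Msg.decide a ∈ h) ∧
    (∀ a, s.pc2 = .relayed a → Msg.decide a ∈ h) ∧
    ∀ a, s.result = some a → ∃ τ, T.alive τ p ∧ Msg.decide a ∈ T.hist τ p)
    (by simp [LocalState.initial]) (fun _ _ _ _ h => h) ?_ ?_ τ p
  · intro τ p out s' ha hres ih h
    obtain ⟨ih1, ih2, ih3⟩ := ih p
    cases h with
    | decideReturn a h =>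
      refine ⟨by simpa using ih1, by simpa using ih2, fun b hb => ?_⟩
      obtain rfl : a = b := by simpa using hb
      exact ⟨τ, ha, ih1 a h⟩
    | _ => simp_all
  · intro τ p out s' ha hres ih h
    obtain ⟨ih1, ih2, ih3⟩ := ih p
    cases h with
    | relayReturn a h =>
      refine ⟨by simpa using ih1, by simpa using ih2, fun b hb => ?_⟩
      obtain rfl : a = b := by simpa using hb
      exact ⟨τ, ha, ih2 a h⟩
    | _ => simp_all

theorem decides_of_sent {τ : ℕ} {p q : Proc} {a : V} (hp : ∀ τ, T.alive τ p)
    (hq : T.alive τ q) (h : Msg.decide a ∈ T.hist τ q) : ∃ τ b, (T.st τ p).result = some b := by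
  obtain ⟨τ', h⟩ := (T.eventually_mem_link h hq hp).exists
  exact T.decides_of_rcvd hp (Multiset.mem_of_le (T.link_le_rcvd τ' q p) h)

theorem card_le_card_filterMap {β : Type*} {f : Msg ID V → Option β} {S : Finset Proc} {τ : ℕ}
    {p : Proc} (h : ∀ q ∈ S, ∃ m ∈ T.link τ q p, (f m).isSome) :
    S.card ≤ ((T.rcvd τ p).filterMap f).card := by
  rw [filterMap_rcvd, Multiset.card_sum, Finset.card_eq_sum_ones]
  refine (Finset.sum_le_sum fun q hq => ?_).trans
    (Finset.sum_le_sum_of_subset (Finset.subset_univ S))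
  obtain ⟨m, hm, hs⟩ := h q hq
  obtain ⟨b, hb⟩ := Option.isSome_iff_exists.1 hs
  exact Multiset.card_pos_iff_exists_mem.2 ⟨b, (Multiset.mem_filterMap _ _).2 ⟨m, hm, hb⟩⟩

theorem card_le_coordValues {S : Finset Proc} {τ r : ℕ} {p : Proc} {i : ID}
    (h : ∀ q ∈ S, ∃ m ∈ T.link τ q p, m.slot = some (16 * r)) (hi : ∀ q ∈ S, ident q = i) :
    S.card ≤ (coordValues i r (T.rcvd τ p)).card := by
  refine T.card_le_card_filterMap fun q hq => ?_
  obtain ⟨m, hm, hs⟩ := h q hq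
  refine ⟨m, hm, ?_⟩
  have hid := T.eq_ident_of_coord τ q
  have hm' := Multiset.mem_of_le (T.link_le_hist τ q p) hm
  cases m <;> simp only [Msg.slot, Option.some.injEq, reduceCtorEq] at hs <;> try omega
  obtain rfl := hid _ _ _ hm'
  simp only [hi q hq, true_and]
  rw [if_pos (by omega)]
  rfl

theorem card_le_ph0Values {S : Finset Proc} {τ r : ℕ} {p : Proc}
    (h : ∀ q ∈ S, ∃ m ∈ T.link τ q p, m.slot = some (16 * r + 5)) :
    S.card ≤ (ph0Values r (T.rcvd τ p)).card := by
  refine T.card_le_card_filterMap fun q hq => ?_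
  obtain ⟨m, hm, hs⟩ := h q hq
  refine ⟨m, hm, ?_⟩
  cases m <;> simp only [Msg.slot, Option.some.injEq, reduceCtorEq] at hs <;> try omega
  simp only [show ∀ r', r' = r ↔ 16 * r' + 5 = 16 * r + 5 by omega, hs, if_true, Option.isSome_some]

theorem card_le_ph1Values {S : Finset Proc} {τ r : ℕ} {p : Proc}
    (h : ∀ q ∈ S, ∃ m ∈ T.link τ q p, m.slot = some (16 * r + 6)) :
    S.card ≤ (ph1Values r (T.rcvd τ p)).card := by
  refine T.card_le_card_filterMap fun q hq => ?_
  obtain ⟨m, hm, hs⟩ := h q hq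
  refine ⟨m, hm, ?_⟩
  cases m <;> simp only [Msg.slot, Option.some.injEq, reduceCtorEq] at hs <;> try omega
  simp only [show ∀ r', r' = r ↔ 16 * r' + 6 = 16 * r + 6 by omega, hs, if_true, Option.isSome_some]

theorem card_le_ph2Values {S : Finset Proc} {τ r : ℕ} {p : Proc}
    (h : ∀ q ∈ S, ∃ m ∈ T.link τ q p, m.slot = some (16 * r + 9)) :
    S.card ≤ (ph2Values r (T.rcvd τ p)).card := by
  refine T.card_le_card_filterMap fun q hq => ?_
  obtain ⟨m, hm, hs⟩ := h q hq
  refine ⟨m, hm, ?_⟩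
  cases m <;> simp only [Msg.slot, Option.some.injEq, reduceCtorEq] at hs <;> try omega
  simp only [show ∀ r', r' = r ↔ 16 * r' + 9 = 16 * r + 9 by omega, hs, if_true, Option.isSome_some]

/-- From time `τ₀` on, the detector elects the correct processes of identity `ℓ`. -/
structure Elects (C : Finset Proc) (ℓ : ID) (τ₀ : ℕ) : Prop where
  mem_iff : ∀ p, p ∈ C ↔ ∀ τ, T.alive τ p
  card_compl_le : Cᶜ.card ≤ t
  exists_leader : ∃ p ∈ C, ident p = ℓ
  leader_eq : ∀ τ ≥ τ₀, ∀ p ∈ C, (D τ p).leader = ℓ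
  multiplicity_eq : ∀ τ ≥ τ₀, ∀ p ∈ C,
    (D τ p).multiplicity = (C.filter fun p => ident p = ℓ).card

namespace Elects

variable {T} {C : Finset Proc} {ℓ : ID} {τ₀ : ℕ} (hE : T.Elects C ℓ τ₀)
include hE

theorem card_ge : Fintype.card Proc - t ≤ C.card := by
  have := Finset.card_compl_add_card C
  have := hE.card_compl_le
  omega

theorem eventually_link {S : Finset Proc} (hS : S ⊆ C) {k : ℕ} (h16 : 16 ≤ k) (hk : IsSlot k)
    (hpos : ∀ q ∈ S, ∃ τ, k < (T.st τ q).pos) {p : Proc} (hp : p ∈ C) :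
    ∀ᶠ τ in atTop, ∀ q ∈ S, ∃ m ∈ T.link τ q p, m.slot = some k := by
  rw [Filter.eventually_all_finset]
  intro q hq
  obtain ⟨τ, hτ⟩ := hpos q hq
  obtain ⟨m, hm, hs⟩ := (T.slots τ q).2.2.2 k h16 hτ hk
  exact (T.eventually_mem_link hm ((hE.mem_iff q).1 (hS hq) τ) ((hE.mem_iff p).1 hp)).mono
    fun τ h => ⟨m, h, hs⟩

/-- As long as nobody decides, a correct process that other processes do not block makes
progress. -/
theorem exists_lt_pos (hres : ∀ τ p, (T.st τ p).result = none)
    (hret : ∀ τ, ∀ p ∈ C, ∀ a, (T.st τ p).pc1 ≠ .decideReturn a) {N : ℕ} {p : Proc} (hp : p ∈ C)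
    (hpN : ∃ τ, N ≤ (T.st τ p).pos)
    (hall : N % 16 = 1 ∨ N % 16 = 7 ∨ N % 16 = 10 → ∀ q ∈ C, ∃ τ, N ≤ (T.st τ q).pos)
    (hlead : N % 16 = 3 → ident p ≠ ℓ → ∃ q ∈ C, ∃ τ, N + 3 ≤ (T.st τ q).pos) :
    ∃ τ, N + 1 ≤ (T.st τ p).pos := by
  by_contra! hcon
  obtain ⟨τ₁, hτ₁⟩ := hpN
  have hpos : ∀ τ ≥ τ₁, (T.st τ p).pos = N := fun τ h =>
    le_antisymm (Nat.le_of_lt_succ (hcon τ)) (hτ₁.trans (T.pos_mono p h))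
  have hN : 15 ≤ N := hpos τ₁ le_rfl ▸ (T.slots τ₁ p).1
  have hsent : N % 16 = 1 ∨ N % 16 = 7 ∨ N % 16 = 10 →
      ∀ {S : Finset Proc}, S ⊆ C → ∀ k < N, 16 ≤ k → IsSlot k →
      ∀ᶠ τ in atTop, ∀ q ∈ S, ∃ m ∈ T.link τ q p, m.slot = some k := by
    intro hmod S hS k hkN h16 hk
    refine hE.eventually_link hS h16 hk (fun q hq => ?_) hp
    obtain ⟨τ, hτ⟩ := hall hmod q (hS hq)
    exact ⟨τ, hkN.trans_le hτ⟩
  have h1 : ∀ᶠ τ in atTop, N % 16 = 1 → ((D τ p).leader ≠ ident p ∨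
      (D τ p).multiplicity ≤ (coordValues (ident p) (N / 16) (T.rcvd τ p)).card) := by
    by_cases hmod : N % 16 = 1
    · by_cases hid : ident p = ℓ
      · filter_upwards [eventually_ge_atTop τ₀, hsent (.inl hmod)
          (Finset.filter_subset (fun q => ident q = ℓ) C) (16 * (N / 16)) (by omega) (by omega)
          (by unfold IsSlot; omega)] with τ hτ h _
        right
        rw [hE.multiplicity_eq τ hτ p hp]
        exact T.card_le_coordValues h fun q hq => hid ▸ (Finset.mem_filter.1 hq).2
      · filter_upwards [eventually_ge_atTop τ₀] with τ hτ _
        left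
        rw [hE.leader_eq τ hτ p hp]
        exact Ne.symm hid
    · exact .of_forall fun _ h => absurd h hmod
  have h2 : ∀ᶠ τ in atTop, N % 16 = 3 → ((D τ p).leader = ident p ∨
      ph0Values (N / 16) (T.rcvd τ p) ≠ 0) := by
    by_cases hid : ident p = ℓ
    · filter_upwards [eventually_ge_atTop τ₀] with τ hτ _
      left
      rw [hE.leader_eq τ hτ p hp, hid]
    · by_cases hmod : N % 16 = 3
      · obtain ⟨q, hq, hqN⟩ := hlead hmod hid
        filter_upwards [hE.eventually_link (Finset.singleton_subset_iff.2 hq)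
          (k := 16 * (N / 16) + 5) (by omega) (by unfold IsSlot; omega)
          (by rintro _ hx; obtain rfl := Finset.mem_singleton.1 hx
              exact hqN.imp fun τ h => by omega) hp] with τ h _
        right
        have := T.card_le_ph0Values h
        rintro h0
        simp [h0] at this
      · exact .of_forall fun _ h => absurd h hmod
  have h3 : ∀ᶠ τ in atTop, N % 16 = 7 →
      Fintype.card Proc - t ≤ (ph1Values (N / 16) (T.rcvd τ p)).card := by
    by_cases hmod : N % 16 = 7
    · filter_upwards [hsent (by omega) subset_rfl (16 * (N / 16) + 6) (by omega) (by omega)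
        (by unfold IsSlot; omega)] with τ h _
      exact hE.card_ge.trans (T.card_le_ph1Values h)
    · exact .of_forall fun _ h => absurd h hmod
  have h4 : ∀ᶠ τ in atTop, N % 16 = 10 →
      Fintype.card Proc - t ≤ (ph2Values (N / 16) (T.rcvd τ p)).card := by
    by_cases hmod : N % 16 = 10
    · filter_upwards [hsent (by omega) subset_rfl (16 * (N / 16) + 9) (by omega) (by omega)
        (by unfold IsSlot; omega)] with τ h _
      exact hE.card_ge.trans (T.card_le_ph2Values h)
    · exact .of_forall fun _ h => absurd h hmod
  -- From some time on every guard that could hold `p` at `N` is true; the next step of T1 given by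
  -- fairness must then move.
  obtain ⟨τ₂, hτ₂⟩ := eventually_atTop.1
    (((h1.and h2).and (h3.and h4)).and (eventually_ge_atTop τ₁))
  obtain ⟨τ, hτ, hm⟩ := T.fair p ((hE.mem_iff p).1 hp) TaskName.T1 τ₂
  obtain ⟨⟨⟨h1, h2⟩, h3, h4⟩, hge⟩ := hτ₂ τ hτ
  rcases T.moves_cases hm with h | ⟨out, -, -, h⟩
  · exact h.1 (hres τ p)
  · have hp0 := hpos τ hge
    have hp1 := hpos (τ + 1) (hge.trans τ.le_succ)
    have := Step1.of_pos_le h (by omega)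
    rw [← LocalState.pos_div, hp0] at this
    rcases this with ⟨h, h'⟩ | ⟨h, h'⟩ | ⟨h, h'⟩ | ⟨h, h'⟩ | ⟨a, h⟩
    · exact h' (h1 h)
    · exact h' (h2 h)
    · exact h' (h3 h)
    · exact h' (h4 h)
    · exact hret τ p hp a h

/-- As long as nobody decides, correct processes are never blocked forever. -/
theorem exists_le_pos (hres : ∀ τ p, (T.st τ p).result = none)
    (hret : ∀ τ, ∀ p ∈ C, ∀ a, (T.st τ p).pc1 ≠ .decideReturn a) (N : ℕ) :
    ∀ p ∈ C, ∃ τ, N ≤ (T.st τ p).pos := by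
  induction N with
  | zero => exact fun p _ => ⟨0, Nat.zero_le _⟩
  | succ N ih =>
    intro p hp
    refine hE.exists_lt_pos hres hret hp (ih p hp) (fun _ => ih) fun hmod _ => ?_
    obtain ⟨q, hq, hid⟩ := hE.exists_leader
    have h1 := hE.exists_lt_pos hres hret hq (ih q hq) (fun _ => ih) (fun _ h => absurd hid h)
    have h2 := hE.exists_lt_pos hres hret hq h1 (by omega) (by omega)
    exact ⟨q, hq, hE.exists_lt_pos hres hret hq h2 (by omega) (by omega)⟩

end Elects

end Liveness

end Trace

/-! ### Termination: the good round -/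

theorem Step1.pos_le_of_decides {ID : Type u} {V : Type w} [DecidableEq ID] [LinearOrder V]
    {n t : ℕ} {i : ID} {d : HOmegaOutput ID} {rcvd : Multiset (Msg ID V)} {s s' : LocalState V}
    {out : Option (Msg ID V)} (h : Step1 n t i d rcvd s out s') {r : ℕ} (hs : s.pos ≤ 16 * r + 13)
    (hdec : s.round = r → s.pc1 = .ph2Evaluate → ∃ a, {e | e ∈ ph2Values s.round rcvd} = {some a}) :
    s'.pos ≤ 16 * r + 13 := by
  unfold LocalState.pos at hs ⊢
  cases h with
  -- Only a jump from stage 11 to stage 15 of round `r` could pass `16 * r + 13`; a unanimous `rec`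
  -- excludes both statements that make it.
  | ph2Adopt h a rec_eq =>
    simp only [h, Pc1.stage] at hs ⊢
    by_contra hlt
    obtain ⟨b, hb⟩ := hdec (by omega) h
    rw [hb] at rec_eq
    have : none ∈ ({some b} : Set (Option V)) := by simp [rec_eq]
    simp at this
  | ph2Skip h rec_ne _ =>
    simp only [h, Pc1.stage] at hs ⊢
    by_contra hlt
    exact rec_ne (hdec (by omega) h)
  | _ => simp_all [Pc1.stage]; try omega

namespace Trace

section Termination

variable {ID : Type u} {V : Type w} [DecidableEq ID] [LinearOrder V] {t : ℕ}
  {Proc : Type z} [Fintype Proc] [DecidableEq Proc] {ident : Proc → ID} {proposal : Proc → V}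
  {D : ℕ → Proc → HOmegaOutput ID}
  {T : Trace (hOmegaConsensus ID V (Fintype.card Proc) t) ident proposal D}

/-- After the coordination phase, the messages of round `r` only carry values satisfying `P`. -/
def _root_.Homonymous.Msg.Carries (r : ℕ) (P : V → Prop) : Msg ID V → Prop
  | .ph0 r' a => r' = r → P a
  | .ph1 r' a => r' = r → P a
  | .ph2 r' e => r' = r → ∃ a, P a ∧ e = some a
  | _ => True

namespace Elects

variable {C : Finset Proc} {ℓ : ID} {τ₀ : ℕ} (hE : T.Elects C ℓ τ₀) {r : ℕ}
  (hr : ∀ τ p, 16 * r ≤ (T.st τ p).pos → p ∈ C ∧ τ₀ ≤ τ)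
include hE hr

/-- By `hr` only correct leaders ever send such messages, at most one each. Having as many messages
as there are correct leaders means having heard from every one of them, so nothing is missing. -/
theorem coordValues_eq {τ : ℕ} {p : Proc}
    (h : (C.filter fun p => ident p = ℓ).card ≤ (coordValues ℓ r (T.rcvd τ p)).card) :
    {b | b ∈ coordValues ℓ r (T.rcvd τ p)} = {b | ∃ q, T.Sent q (.coord ℓ r b)} := by
  classical
  have hmem : ∀ q b, T.Sent q (.coord ℓ r b) → q ∈ C.filter fun p => ident p = ℓ := by
    rintro q b ⟨τ, hq⟩
    exact Finset.mem_filter.2 ⟨(hr τ q (T.lt_pos hq (k := 16 * r) rfl).le).1,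
      (T.eq_ident_of_coord τ q _ _ _ hq).symm⟩
  have heq : (Finset.univ.filter fun q => ∃ a, Msg.coord ℓ r a ∈ T.link τ q p) =
      C.filter fun p => ident p = ℓ := by
    refine Finset.eq_of_subset_of_card_le (fun q hq => ?_)
      (h.trans (T.card_coordValues_le τ p ℓ r))
    obtain ⟨a, ha⟩ := (Finset.mem_filter.1 hq).2
    exact hmem q a (sent_of_mem_link ha)
  ext b
  refine ⟨fun hb => exists_sent_of_mem_rcvd (mem_coordValues.1 hb), ?_⟩
  rintro ⟨q, hq⟩
  have := hmem q b hq
  rw [← heq] at this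
  obtain ⟨a, ha⟩ := (Finset.mem_filter.1 this).2
  have := (sent_of_mem_link ha).eq hq (k := 16 * r) rfl rfl
  cases this
  exact mem_coordValues.2 (Multiset.mem_of_le (T.link_le_rcvd τ q p) ha)

/-- A round that is executed by correct processes only, once the detector is stable, ends with a
decision. -/
theorem pos_le (hr1 : 1 ≤ r) (ht : 2 * t < Fintype.card Proc) (τ : ℕ) (p : Proc) :
    (T.st τ p).pos ≤ 16 * r + 13 := by
  -- The common value of the round: the minimum over all coordination messages of the leaders, at
  -- whatever time they are sent. `P` has at most one solution, and that is all the later phases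
  -- need.
  set P : V → Prop := fun a => IsLeast {b | ∃ q, T.Sent q (.coord ℓ r b)} a with hP
  have huniq : ∀ a b, P a → P b → a = b := fun a b ha hb => ha.unique hb
  clear_value P
  set c := (C.filter fun p => ident p = ℓ).card with hc
  have hcpos : 0 < c := by
    obtain ⟨q, hq, hid⟩ := hE.exists_leader
    exact Finset.card_pos.2 ⟨q, Finset.mem_filter.2 ⟨hq, hid⟩⟩
  have monoc : ∀ τ p, (coordValues ℓ r (T.rcvd τ p)).card ≤
      (coordValues ℓ r (T.rcvd (τ + 1) p)).card := fun τ p =>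
    Multiset.card_le_card (Multiset.filterMap_le_filterMap _ (T.rcvd_mono p τ.le_succ))
  have mono0 : ∀ τ p, ph0Values r (T.rcvd τ p) ≠ 0 → ph0Values r (T.rcvd (τ + 1) p) ≠ 0 := by
    intro τ p h h'
    refine h (Multiset.le_zero.1 ?_)
    rw [← h']
    exact Multiset.filterMap_le_filterMap _ (T.rcvd_mono p τ.le_succ)
  suffices H : (T.st τ p).pos ≤ 16 * r + 13 ∧ ((T.st τ p).round = r →
      ((T.st τ p).pc1 = .coordUpdate → ident p = ℓ → c ≤ (coordValues ℓ r (T.rcvd τ p)).card) ∧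
      ((T.st τ p).pc1 = .ph0Wait ∨ (T.st τ p).pc1 = .ph0Update → ident p = ℓ →
        P (T.st τ p).est1) ∧
      ((T.st τ p).pc1 = .ph0Update → ident p ≠ ℓ → ph0Values r (T.rcvd τ p) ≠ 0) ∧
      ((T.st τ p).pc1 = .ph0Broadcast ∨ (T.st τ p).pc1 = .ph1Broadcast → P (T.st τ p).est1) ∧
      ((T.st τ p).pc1 = .ph2Broadcast → ∃ a, P a ∧ (T.st τ p).est2 = some a)) ∧
      ∀ m ∈ T.hist τ p, m.Carries r P from H.1
  refine T.induct (fun τ p s h => s.pos ≤ 16 * r + 13 ∧ (s.round = r →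
      (s.pc1 = .coordUpdate → ident p = ℓ → c ≤ (coordValues ℓ r (T.rcvd τ p)).card) ∧
      (s.pc1 = .ph0Wait ∨ s.pc1 = .ph0Update → ident p = ℓ → P s.est1) ∧
      (s.pc1 = .ph0Update → ident p ≠ ℓ → ph0Values r (T.rcvd τ p) ≠ 0) ∧
      (s.pc1 = .ph0Broadcast ∨ s.pc1 = .ph1Broadcast → P s.est1) ∧
      (s.pc1 = .ph2Broadcast → ∃ a, P a ∧ s.est2 = some a)) ∧
      ∀ m ∈ h, m.Carries r P) ?_ ?_ ?_ ?_ τ p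
  · intro p
    refine ⟨?_, by simp [LocalState.initial], by simp⟩
    have hpos : (LocalState.initial (proposal p)).pos = 15 := rfl
    omega
  · intro τ p s h ⟨h1, h2, h3⟩
    refine ⟨h1, fun hs => ?_, h3⟩
    obtain ⟨ha, hb, hc, hd⟩ := h2 hs
    exact ⟨fun h h' => (ha h h').trans (monoc τ p), hb, fun h h' => mono0 τ p (hc h h'), hd⟩
  · intro τ p out s' _ _ ih h
    obtain ⟨ih1, ih2, ih3⟩ := ih p
    have hrcvd : ∀ m ∈ T.rcvd τ p, m.Carries r P :=
      fun m hm => let ⟨q, hq⟩ := T.exists_mem_hist hm; (ih q).2.2 m hq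
    have hround : (T.st τ p).round = r → p ∈ C ∧ τ₀ ≤ τ := fun h =>
      hr τ p (by unfold LocalState.pos; omega)
    have hD : (T.st τ p).round = r → (D τ p).leader = ℓ ∧ (D τ p).multiplicity = c := fun h =>
      ⟨hE.leader_eq τ (hround h).2 p (hround h).1, hE.multiplicity_eq τ (hround h).2 p (hround h).1⟩
    have hph0 : (T.st τ p).round = r → ∀ a ∈ ph0Values (T.st τ p).round (T.rcvd τ p), P a :=
      fun h a ha => hrcvd _ (mem_ph0Values.1 ha) h
    have hph1 : (T.st τ p).round = r → ∀ a ∈ ph1Values (T.st τ p).round (T.rcvd τ p), P a :=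
      fun h a ha => hrcvd _ (mem_ph1Values.1 ha) h
    have hph2 : (T.st τ p).round = r → ∀ e ∈ ph2Values (T.st τ p).round (T.rcvd τ p),
        ∃ a, P a ∧ e = some a :=
      fun h a ha => hrcvd _ (mem_ph2Values.1 ha) h
    have hmaj : (T.st τ p).round = r → (T.st τ p).pc1 = .ph1Update → ∃ a,
        Fintype.card Proc < 2 * (ph1Values (T.st τ p).round (T.rcvd τ p)).count a := by
      intro h h'
      have hq := (T.quorum_rcvd τ p).1 h'
      obtain ⟨a, ha⟩ := Multiset.card_pos_iff_exists_mem.1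
        (show 0 < (ph1Values (T.st τ p).round (T.rcvd τ p)).card by omega)
      refine ⟨a, ?_⟩
      -- All PH1 values received are equal, so their count is the whole quorum, and `n - t` exceeds
      -- `n / 2`.
      rw [Multiset.count_eq_card.2 fun b hb => huniq _ _ (hph1 h a ha) (hph1 h b hb)]
      omega
    have hdec : (T.st τ p).round = r → (T.st τ p).pc1 = .ph2Evaluate → ∃ a,
        {e | e ∈ ph2Values (T.st τ p).round (T.rcvd τ p)} = {some a} := by
      intro h h'
      have hq := (T.quorum_rcvd τ p).2 h'
      obtain ⟨e, he⟩ := Multiset.card_pos_iff_exists_mem.1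
        (show 0 < (ph2Values (T.st τ p).round (T.rcvd τ p)).card by omega)
      obtain ⟨a, ha, rfl⟩ := hph2 h e he
      refine ⟨a, Set.Subset.antisymm (fun e' he' => ?_) (by simpa using he)⟩
      obtain ⟨b, hb, rfl⟩ := hph2 h e' he'
      rw [huniq b a hb ha]
      rfl
    have hleast : (T.st τ p).round = r → (T.st τ p).pc1 = .coordUpdate → ident p = ℓ →
        {b | b ∈ coordValues ℓ r (T.rcvd τ p)} = {b | ∃ q, T.Sent q (.coord ℓ r b)} :=
      fun h h1 h2 => hE.coordValues_eq hr ((ih2 h).1 h1 h2)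
    have hmc := monoc τ p
    have hm0 := mono0 τ p
    have hout : ∀ m, out = some m → m.Carries r P := by
      intro m hm
      cases h <;> simp only [Option.some.injEq, reduceCtorEq] at hm <;> subst hm <;>
        simp only [Msg.Carries] <;> intro hround'
      · exact (ih2 hround').2.2.2.1 (.inl ‹_›)
      · exact (ih2 hround').2.2.2.1 (.inr ‹_›)
      · exact (ih2 hround').2.2.2.2 ‹_›
    have hmsg : ∀ m ∈ out.elim 0 (fun m => {m}) + T.hist τ p, m.Carries r P := by
      intro m hm
      rcases Multiset.mem_add.1 hm with hm | hm
      · cases out with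
        | none => simp at hm
        | some m' =>
          obtain rfl : m = m' := by simpa using hm
          exact hout m rfl
      · exact ih3 m hm
    clear hout
    refine ⟨?_, fun hs => ?_, hmsg⟩
    · exact h.pos_le_of_decides ih1 hdec
    · clear hmsg
      cases h with
      | coordPass h guard =>
        have ⟨h1, h2⟩ := hD hs
        refine ⟨fun _ hid => ?_, by simp, by simp, by simp, by simp⟩
        rw [h1, h2, hid] at guard
        replace hs : (T.st τ p).round = r := hs
        rw [hs] at guard
        exact (guard.resolve_left (by simp)).trans hmc
      | coordUpdate h a least =>
        refine ⟨by simp, fun _ hid => ?_, by simp, by simp, by simp⟩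
        have := hleast hs h hid
        replace hs : (T.st τ p).round = r := hs
        rw [hid, hs, this] at least
        rw [hP]
        exact least
      | coordSkip h empty =>
        refine ⟨by simp, fun _ hid => ?_, by simp, by simp, by simp⟩
        -- A leader holds at least `c > 0` coordination messages, so it cannot skip the update.
        have := (ih2 hs).1 h hid
        replace hs : (T.st τ p).round = r := hs
        rw [hid, hs] at empty
        rw [empty] at this
        simp at this
        omega
      | ph0Pass h guard =>
        refine ⟨by simp, fun _ hid => (ih2 hs).2.1 (.inl h) hid, fun _ hid => ?_, by simp, by simp⟩
        have h1 := (hD hs).1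
        replace hs : (T.st τ p).round = r := hs
        rw [h1, hs] at guard
        exact hm0 (guard.resolve_left (Ne.symm hid))
      | ph0Blocked h _ =>
        have := (ih2 hs).2.1 (.inl h)
        exact ⟨by simp [h], fun _ => this, by simp [h], by simp [h], by simp [h]⟩
      | ph0Update h a mem =>
        exact ⟨by simp, by simp, by simp, fun _ => hph0 hs a mem, by simp⟩
      | ph0Skip h empty =>
        refine ⟨by simp, by simp, by simp, fun _ => ?_, by simp⟩
        by_cases hid : ident p = ℓ
        · exact (ih2 hs).2.1 (.inr h) hid
        · have := (ih2 hs).2.2.1 h hid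
          replace hs : (T.st τ p).round = r := hs
          rw [hs] at empty
          exact absurd empty this
      | ph0Broadcast h =>
        exact ⟨by simp, by simp, by simp, fun _ => (ih2 hs).2.2.2.1 (.inl h), by simp⟩
      | ph1Majority h a majority =>
        refine ⟨by simp, by simp, by simp, by simp, fun _ => ⟨a, hph1 hs a ?_, rfl⟩⟩
        exact Multiset.count_pos.1 (by omega)
      | ph1NoMajority h no_majority => exact absurd (hmaj hs h) no_majority
      | _ =>
        clear hrcvd hround hD hph0 hph1 hph2 hmaj hdec hleast ih ih1 ih2 ih3 huniq hP hm0 hmc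
        simp_all
  · intro τ p out s' _ _ ih h
    obtain ⟨ih1, ih2, ih3⟩ := ih p
    have hmc := monoc τ p
    have hm0 := mono0 τ p
    rw [h.pos_eq]
    refine ⟨ih1, fun hs => ?_, ?_⟩
    · have : (T.st τ p).round = r := by cases h <;> exact hs
      obtain ⟨h1, h2, h3, h4, h5⟩ := ih2 this
      cases h <;> exact ⟨fun h h' => (h1 h h').trans hmc, h2, fun h h' => hm0 (h3 h h'), h4, h5⟩
    · intro m hm
      rcases Multiset.mem_add.1 hm with hm | hm
      · rcases h.out_eq with rfl | ⟨b, rfl⟩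
        · simp at hm
        · obtain rfl : m = .decide b := by simpa using hm
          trivial
      · exact ih3 m hm

-- If `p` never decides, no live process has broadcast DECIDE, so nobody returns and every correct
-- process advances forever. This contradicts the bound that `pos_le` gives for a good round.
omit hr in
theorem decides (ht : 2 * t < Fintype.card Proc) {p : Proc} (hp : p ∈ C) :
    ∃ τ a, (T.st τ p).result = some a := by
  by_contra! hcon
  have hdecide : ∀ {τ q a}, T.alive τ q → Msg.decide a ∉ T.hist τ q := by
    intro τ q a hq hm
    obtain ⟨τ, b, h⟩ := T.decides_of_sent ((hE.mem_iff p).1 hp) hq hm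
    exact hcon τ b h
  have hres : ∀ τ q, (T.st τ q).result = none := by
    intro τ q
    refine Option.eq_none_iff_forall_ne_some.2 fun a ha => ?_
    obtain ⟨τ, hq, hm⟩ := (T.decide_sent τ q).2.2 a ha
    exact hdecide hq hm
  have hret : ∀ τ, ∀ q ∈ C, ∀ a, (T.st τ q).pc1 ≠ .decideReturn a := fun τ q hq a ha =>
    hdecide ((hE.mem_iff q).1 hq τ) ((T.decide_sent τ q).1 a ha)
  have hcrash : ∀ᶠ τ in Filter.atTop, ∀ q, q ∉ C → ¬ T.alive τ q := by
    rw [Filter.eventually_all]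
    intro q
    by_cases hq : q ∈ C
    · exact .of_forall fun _ h => absurd hq h
    · obtain ⟨τ, hτ⟩ := not_forall.1 (mt (hE.mem_iff q).2 hq)
      exact Filter.eventually_atTop.2 ⟨τ, fun τ' h _ ha => hτ (T.alive_anti q h ha)⟩
  obtain ⟨τ₁, hτ₁, hge⟩ := (hcrash.and (Filter.eventually_ge_atTop τ₀)).exists
  have hconst : ∀ q ∉ C, ∀ τ ≥ τ₁, T.st τ q = T.st τ₁ q := by
    intro q hq τ hτ
    induction hτ with
    | refl => rfl
    | @step τ h ih =>
      rcases T.step_cases τ q with ⟨h', -⟩ | ⟨h', -⟩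
      · rw [h', ih]
      · exact absurd (T.alive_anti q h h') (hτ₁ q hq)
  -- At time `τ₁` all crashes are over and the detector is stable. The sum exceeds no bound that
  -- matters except that it dominates every current position, so round `r` is still ahead of
  -- everyone; adding 1 makes this strict and gives `1 ≤ r`. Faulty processes are frozen and never
  -- reach it.
  set r := (∑ q, (T.st τ₁ q).pos) + 1 with hrdef
  have hlt : ∀ q, (T.st τ₁ q).pos < r := fun q => Nat.lt_succ_of_le
    (Finset.single_le_sum (f := fun q => (T.st τ₁ q).pos) (fun _ _ => Nat.zero_le _)
      (Finset.mem_univ q))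
  have hr : ∀ τ q, 16 * r ≤ (T.st τ q).pos → q ∈ C ∧ τ₀ ≤ τ := by
    intro τ q h
    have hq := hlt q
    have hτ : τ₁ ≤ τ := by
      by_contra hτ
      have : (T.st τ q).pos ≤ (T.st τ₁ q).pos := T.pos_mono q (le_of_not_ge hτ)
      omega
    refine ⟨?_, le_trans hge hτ⟩
    by_contra hqC
    rw [hconst q hqC τ hτ] at h
    omega
  -- One more than the bound `16 * r + 13` of `pos_le`.
  obtain ⟨τ, hτ⟩ := hE.exists_le_pos hres hret (16 * r + 14) p hp
  have := hE.pos_le hr (by omega) ht τ p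
  omega

end Elects

end Termination

end Trace

/-! ### From the class HΩ to the three requirements of consensus -/

theorem count_identities {ID : Type u} [DecidableEq ID] {Proc : Type z} (ident : Proc → ID)
    (S : Finset Proc) (ℓ : ID) :
    (identities ident S).count ℓ = (S.filter fun p => ident p = ℓ).card := by
  rw [identities, Multiset.count_map, Finset.card_def, Finset.filter_val]
  simp only [eq_comm]

end Homonymous

theorem mainTheorem2 {ID V Proc : Type*} [DecidableEq ID] [LinearOrder V]
    [Fintype Proc] [DecidableEq Proc] (t : ℕ) (ht : 2 * t < Fintype.card Proc) :
    Homonymous.SolvesConsensus Proc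
      (Homonymous.hOmegaConsensus ID V (Fintype.card Proc) t) t Homonymous.HOmega := by
  intro ident proposal D R hR hcard hD
  obtain ⟨T, hT, halive⟩ := hR.exists_trace Homonymous.hOmegaConsensus_returned_broadcast
  have hres : ∀ {p τ a}, R.Decided p τ a ↔ (T.st τ p).result = some a := by
    intro p τ a
    unfold Homonymous.Run.Decided
    rw [← hT τ p]
    rfl
  obtain ⟨ℓ, hℓ, τ₀, hD⟩ := hD
  obtain ⟨q, hq, hid⟩ := Multiset.mem_map.1 hℓ
  have hE : T.Elects R.correct ℓ τ₀ :=
    { mem_iff := fun p => (halive p).symm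
      card_compl_le := hcard
      exists_leader := ⟨q, hq, hid⟩
      leader_eq := fun τ hτ p hp => (hD τ hτ p hp).1
      multiplicity_eq := fun τ hτ p hp =>
        (hD τ hτ p hp).2.trans (Homonymous.count_identities ident R.correct ℓ) }
  refine ⟨fun p τ a h => ?_, fun p q τ τ' a b ha hb => ?_, fun p hp => ?_⟩
  · obtain ⟨r, hr⟩ := (T.locked_of_decide τ p).2.2.1 a (hres.1 h)
    exact hr.proposed ht
  · obtain ⟨r, hr⟩ := (T.locked_of_decide τ p).2.2.1 a (hres.1 ha)
    obtain ⟨r', hr'⟩ := (T.locked_of_decide τ' q).2.2.1 b (hres.1 hb)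
    exact hr.unique ht hr'
  · obtain ⟨τ, a, h⟩ := hE.decides ht hp
    exact ⟨τ, a, hres.2 h⟩
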